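/- **Conventions.** Let $d\ge 1$. Measures, norms and integrals on $\mathbb{R}^d$ without further specification refer to Lebesgue measure and $|\cdot|$ is the Euclidean norm. A Young function is a convex function $\Phi:[0,\infty)\to[0,\infty]$ with $\Phi(0)=0$ and $\lim_{x\to\infty}\Phi(x)=\infty$; it is an N-function if moreover it is continuous (for the topology of $[0,\infty]$), $\Phi(x)=0$ only for $x=0$, $\lim_{x\to0}\Phi(x)/x=0$ and $\lim_{x\to\infty}\Phi(x)/x=\infty$. Put $\Psi(x)=\sup_{y\ge0}\{yx-\Phi(y)\}$ (the complementary function) and $\Phi^{-1}(x)=\inf\{y\ge0:\Phi(y)>x\}$. $\Psi$ satisfies the $\Delta_2$-condition if $\Psi(2x)\le C\Psi(x)$ for some $C>0$ and all $x>0$. $L^\Phi(\mathbb{R}^d)$ is the set of measurable $f$ with $\int\Phi(\alpha|f|)\,dx<\infty$ for some $\alpha>0$, with $\|f\|_{L^\Phi}=\inf\{t>0:\int\Phi(|f|/t)\,dx\le1\}$ (the same formula, with $\Phi(\infty):=\infty$, is used for $[0,\infty]$-valued functions); $L^\Psi(\mathbb{R}^d)$ is defined in the same way. $W^{1,\Phi}(\mathbb{R}^d)$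 is the set of $f\in L^\Phi(\mathbb{R}^d)$ having a weak gradient $Df$ with $|Df|\in L^\Phi(\mathbb{R}^d)$. For $g\ge0$ measurable, $\|f\|_{L^r(\mathbb{R}^d,g)}=(\int|f|^rg\,dx)^{1/r}$ if $r<\infty$ and $\|f\|_{L^\infty(\mathbb{R}^d,g)}=\operatorname{ess\,sup}|f|$ (Lebesgue); $L^r(\mathbb{R}^d,g)$ is the set of $f$ for which this is finite. $1/\infty=0$. For a measure $\nu$ let $M_R\nu(x)=\sup_{0<s\le R}\nu(B(x;s))/\mathrm{Leb}(B(x;s))$ and $M\nu=\sup_{R>0}M_R\nu$, with $B(x;s)$ the closed ball; for a real or vector valued function $F$ let $MF$, $M_RF$ be those of the measure $|F(x)|\,dx$. **Theorem.** Let $\Phi$ be an N-function whose complementary function $\Psi$ satisfies the $\Delta_2$-condition. (0) There are constants $K_0,A_1>0$, depending only on $d$, and $A_\Phi>0$, depending only on $d$ and $\Phi$, such that (a) for every locally integrable $f$ with locally integrable weak gradient $Df$ there is a null set $N$ such that, for all $x,y\notin N$, $|f(x)-f(y)|\le K_0|x-y|\{M_{2|x-y|}(Df)(x)+M_{2|x-y|}(Df)(y)\}$;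 (b) $\mathrm{Leb}(\{M\nu>t\})\le A_1\,\nu(\mathbb{R}^d)\,t^{-1}$ for every finite Borel measure $\nu$ on $\mathbb{R}^d$ and $t>0$; (c) $\|Mf\|_{L^\Phi}\le A_\Phi\|f\|_{L^\Phi}$ for every $f\in L^\Phi(\mathbb{R}^d)$. Let $X,\widehat X$ be $\mathbb{R}^d$-valued random variables on a probability space with density functions $p_X,p_{\widehat X}$ with respect to Lebesgue measure, let $r\in(1,\infty]$, $f\in W^{1,\Phi}(\mathbb{R}^d)\cap L^r(\mathbb{R}^d,p_X)\cap L^r(\mathbb{R}^d,p_{\widehat X})$ and $q\in(0,r)$. Let $K_0>0$ be any constant for which the estimate in (a) holds for this $f$, and $A_1,A_\Phi>0$ any constants for which (b), (c) hold. (1) If $p_X,p_{\widehat X}\in L^\infty(\mathbb{R}^d)$, then for every $\alpha>0$ with $\int\Phi(\alpha|Df|)\,dx<\infty$, $$\mathbb{E}\big[|f(X)-f(\widehat X)|^q\big]\le C_\infty\inf_{\lambda>0}\Big\{\lambda^{-(1-\frac qr)}+(\Phi^{-1}(\lambda))^q\,\mathbb{E}\big[|X-\widehat X|^q\big]\Big\},$$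 $$C_\infty=\max\Big\{\Big(\tfrac{2K_0}{\alpha}\Big)^q,\ \big(\|f\|_{L^r(\mathbb{R}^d,p_X)}+\|f\|_{L^r(\mathbb{R}^d,p_{\widehat X})}\big)^q\big(A_1\{\|p_X\|_\infty+\|p_{\widehat X}\|_\infty\}\|\Phi(\alpha|Df|)\|_{L^1}\big)^{1-\frac qr}\Big\}<\infty .$$ (2) If $p_X,p_{\widehat X}\in L^\Psi(\mathbb{R}^d)$, then $$\mathbb{E}\big[|f(X)-f(\widehat X)|^q\big]\le C_\Psi\,\mathbb{E}\big[|X-\widehat X|^q\big]^{\frac{1-q/r}{q+1-q/r}},$$ $$C_\Psi=(2K_0)^q+\big(\|f\|_{L^r(\mathbb{R}^d,p_X)}+\|f\|_{L^r(\mathbb{R}^d,p_{\widehat X})}\big)^q\big(2A_\Phi\{\|p_X\|_{L^\Psi}+\|p_{\widehat X}\|_{L^\Psi}\}\||Df|\|_{L^\Phi}\big)^{1-\frac qr}<\infty .$$ Expectations are taken in $[0,\infty]$ and may be infinite. -/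

import Mathlib

open MeasureTheory Filter Topology Set
open scoped ENNReal NNReal

noncomputable section

namespace OrliczAvikainen

/-- Euclidean space of dimension `d`. -/
abbrev Rd (d : ℕ) : Type := EuclideanSpace ℝ (Fin d)

/-! ### Young functions and N-functions -/

/-- A Young function: a convex function from `[0, ∞)` to `[0, ∞]`, vanishing at `0` and tending
to `∞` at `∞`. -/
structure IsYoung (Φ : ℝ≥0 → ℝ≥0∞) : Prop where
  convex : ConvexOn ℝ≥0 univ Φ
  map_zero : Φ 0 = 0
  tendsto_top : Tendsto Φ atTop (𝓝 ∞)

/-- An N-function. Continuity is with respect to the usual topology of `[0, ∞]`. -/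
structure IsNFunction (Φ : ℝ≥0 → ℝ≥0∞) : Prop extends IsYoung Φ where
  continuous : Continuous Φ
  eq_zero_iff : ∀ x, Φ x = 0 ↔ x = 0
  tendsto_div_zero : Tendsto (fun x : ℝ≥0 => Φ x / (x : ℝ≥0∞)) (𝓝[>] 0) (𝓝 0)
  tendsto_div_atTop : Tendsto (fun x : ℝ≥0 => Φ x / (x : ℝ≥0∞)) atTop (𝓝 ∞)

/-- The complementary function `Ψ x = sup_{y ≥ 0} (y x - Φ y)`. The subtraction of `[0, ∞]` is
truncated at `0`, which does not change the supremum because `y = 0` contributes `0`. -/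
def complementary (Φ : ℝ≥0 → ℝ≥0∞) (x : ℝ≥0) : ℝ≥0∞ :=
  ⨆ y : ℝ≥0, (y : ℝ≥0∞) * (x : ℝ≥0∞) - Φ y

/-- The generalized inverse `Φ⁻¹ x = inf {y ≥ 0 ; Φ y > x}` (with `inf ∅ = ∞`). -/
def genInverse (Φ : ℝ≥0 → ℝ≥0∞) (x : ℝ≥0∞) : ℝ≥0∞ :=
  ⨅ (y : ℝ≥0) (_ : x < Φ y), (y : ℝ≥0∞)

/-- The `Δ₂`-condition. -/
def Delta2 (Φ : ℝ≥0 → ℝ≥0∞) : Prop :=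
  ∃ C : ℝ≥0, 0 < C ∧ ∀ x : ℝ≥0, 0 < x → Φ (2 * x) ≤ C * Φ x

/-! ### Orlicz and Orlicz--Sobolev spaces

A function enters an Orlicz space only through its absolute value, so the modular, the membership
and the norm are defined for `[0, ∞]`-valued functions `u` and used with `u = |f|`, with densities,
and with maximal functions (which may take the value `∞`). -/

/-- `Φ` extended to `[0, ∞]` by `Φ ∞ = ∞`. -/
def extend (Φ : ℝ≥0 → ℝ≥0∞) (t : ℝ≥0∞) : ℝ≥0∞ :=
  if t = ∞ then ∞ else Φ t.toNNReal

/-- The modular `∫ Φ(u(x)) dx`. -/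
def modular {d : ℕ} (Φ : ℝ≥0 → ℝ≥0∞) (u : Rd d → ℝ≥0∞) : ℝ≥0∞ :=
  ∫⁻ x, extend Φ (u x)

/-- Membership in the Orlicz space `L^Φ(ℝ^d)`: `∫ Φ(α u) dx < ∞` for some `α > 0`. -/
def MemOrlicz {d : ℕ} (Φ : ℝ≥0 → ℝ≥0∞) (u : Rd d → ℝ≥0∞) : Prop :=
  AEMeasurable u ∧ ∃ α : ℝ≥0, 0 < α ∧ modular Φ (fun x => α * u x) < ∞

/-- The Luxemburg norm `inf {t > 0 ; ∫ Φ(u / t) dx ≤ 1}`. -/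
def luxNorm {d : ℕ} (Φ : ℝ≥0 → ℝ≥0∞) (u : Rd d → ℝ≥0∞) : ℝ≥0∞ :=
  ⨅ (t : ℝ≥0) (_ : 0 < t ∧ modular Φ (fun x => u x / t) ≤ 1), (t : ℝ≥0∞)

/-- `G` is the vector of first order weak partial derivatives of `f` on `ℝ^d`. -/
structure HasWeakGradient {d : ℕ} (f : Rd d → ℝ) (G : Rd d → Rd d) : Prop where
  locallyIntegrable : LocallyIntegrable f
  locallyIntegrable_grad : LocallyIntegrable G
  integral_eq : ∀ (φ : Rd d → ℝ), ContDiff ℝ (⊤ : ℕ∞) φ → HasCompactSupport φ → ∀ i : Fin d,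
    ∫ x, f x * fderiv ℝ φ x (EuclideanSpace.single i 1) = - ∫ x, G x i * φ x

/-- `f ∈ W^{1,Φ}(ℝ^d)`, with weak gradient `Df`. -/
structure MemOrliczSobolev {d : ℕ} (Φ : ℝ≥0 → ℝ≥0∞) (f : Rd d → ℝ) (Df : Rd d → Rd d) : Prop where
  mem : MemOrlicz Φ (fun x => ‖f x‖ₑ)
  weakGradient : HasWeakGradient f Df
  mem_grad : MemOrlicz Φ (fun x => ‖Df x‖ₑ)

/-- The norm of `L^r(ℝ^d, g)`: `(∫ |f|^r g dx)^{1/r}` if `r < ∞`, and the essential supremum of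
`|f|` with respect to Lebesgue measure if `r = ∞`. -/
def weightedNorm {d : ℕ} (r : ℝ≥0∞) (g : Rd d → ℝ≥0) (f : Rd d → ℝ) : ℝ≥0∞ :=
  if r = ∞ then essSup (fun x => ‖f x‖ₑ) volume
  else (∫⁻ x, ‖f x‖ₑ ^ r.toReal * g x) ^ (1 / r.toReal)

/-! ### Maximal functions and the constants of the classical estimates -/

/-- The Hardy--Littlewood maximal function of a measure `ν` (over closed centred balls). -/
def maximal {d : ℕ} (ν : Measure (Rd d)) (x : Rd d) : ℝ≥0∞ :=
  ⨆ (s : ℝ) (_ : 0 < s), ν (Metric.closedBall x s) / volume (Metric.closedBall x s)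

/-- The restricted Hardy--Littlewood maximal function `M_R ν`, over radii `0 < s ≤ R`. -/
def maximalRestricted {d : ℕ} (R : ℝ) (ν : Measure (Rd d)) (x : Rd d) : ℝ≥0∞ :=
  ⨆ (s : ℝ) (_ : 0 < s ∧ s ≤ R), ν (Metric.closedBall x s) / volume (Metric.closedBall x s)

/-- The total variation measure `|F(x)| dx` of a real or vector valued function `F`. -/
def absMeasure {d : ℕ} {V : Type} [NormedAddCommGroup V] (F : Rd d → V) : Measure (Rd d) :=
  volume.withDensity (fun x => ‖F x‖ₑ)

/-- `K` is a constant of the pointwise estimate for `f` with gradient `Df`: off a null set,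
`|f x - f y| ≤ K |x - y| (M_{2|x-y|}(Df)(x) + M_{2|x-y|}(Df)(y))`. -/
def IsPointwiseConst {d : ℕ} (f : Rd d → ℝ) (Df : Rd d → Rd d) (K : ℝ≥0) : Prop :=
  0 < K ∧ ∃ N : Set (Rd d), volume N = 0 ∧ ∀ x ∉ N, ∀ y ∉ N,
    ‖f x - f y‖ₑ ≤ K * ‖x - y‖ₑ *
      (maximalRestricted (2 * ‖x - y‖) (absMeasure Df) x +
        maximalRestricted (2 * ‖x - y‖) (absMeasure Df) y)

/-- `A` is a constant of the weak type estimate for the maximal operator on finite measures. -/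
def IsWeakTypeConst (d : ℕ) (A : ℝ≥0) : Prop :=
  0 < A ∧ ∀ ν : Measure (Rd d), IsFiniteMeasure ν → ∀ t : ℝ≥0, 0 < t →
    volume {x | (t : ℝ≥0∞) < maximal ν x} ≤ A * ν univ / t

/-- `A` is a constant of the strong type estimate for the maximal operator on `L^Φ(ℝ^d)`. -/
def IsStrongTypeConst (d : ℕ) (Φ : ℝ≥0 → ℝ≥0∞) (A : ℝ≥0) : Prop :=
  0 < A ∧ ∀ f : Rd d → ℝ, AEMeasurable f → MemOrlicz Φ (fun x => ‖f x‖ₑ) →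
    luxNorm Φ (maximal (absMeasure f)) ≤ A * luxNorm Φ (fun x => ‖f x‖ₑ)

/-! ### Densities and the constants of the theorem -/

/-- `p` is a density function of the random variable `X` with respect to Lebesgue measure. -/
structure IsDensity {d : ℕ} {Ω : Type*} [MeasurableSpace Ω] (P : Measure Ω) (X : Ω → Rd d)
    (p : Rd d → ℝ≥0) : Prop where
  measurable : Measurable p
  map_eq : P.map X = volume.withDensity (fun x => (p x : ℝ≥0∞))

/-- The norm of a density in `L^∞(ℝ^d)`. -/
def supNorm {d : ℕ} (p : Rd d → ℝ≥0) : ℝ≥0∞ := essSup (fun x => (p x : ℝ≥0∞)) volume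

/-- The exponent `1 - q / r`, with `q / ∞ = 0`. -/
def gap (q : ℝ) (r : ℝ≥0∞) : ℝ := 1 - q * (r⁻¹).toReal

/-- The constant of the estimate for bounded densities `p`, `p'`. -/
def constBounded {d : ℕ} (Φ : ℝ≥0 → ℝ≥0∞) (f : Rd d → ℝ) (Df : Rd d → Rd d)
    (p p' : Rd d → ℝ≥0) (q : ℝ) (r : ℝ≥0∞) (α K₀ A₁ : ℝ≥0) : ℝ≥0∞ :=
  max ((2 * (K₀ : ℝ≥0∞) / α) ^ q)
    ((weightedNorm r p f + weightedNorm r p' f) ^ q *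
      (A₁ * (supNorm p + supNorm p') * modular Φ (fun x => α * ‖Df x‖ₑ)) ^ gap q r)

/-- The constant of the estimate for densities `p`, `p'` in `L^Ψ(ℝ^d)`, `Ψ` being the
complementary function of `Φ`. -/
def constOrlicz {d : ℕ} (Φ : ℝ≥0 → ℝ≥0∞) (f : Rd d → ℝ) (Df : Rd d → Rd d)
    (p p' : Rd d → ℝ≥0) (q : ℝ) (r : ℝ≥0∞) (K₀ AΦ : ℝ≥0) : ℝ≥0∞ :=
  (2 * (K₀ : ℝ≥0∞)) ^ q +
    (weightedNorm r p f + weightedNorm r p' f) ^ q *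
      (2 * AΦ * (luxNorm (complementary Φ) (fun x => (p x : ℝ≥0∞)) +
          luxNorm (complementary Φ) (fun x => (p' x : ℝ≥0∞))) *
        luxNorm Φ (fun x => ‖Df x‖ₑ)) ^ gap q r

end OrliczAvikainen

end

open OrliczAvikainen

namespace OrliczAvikainen

/-! ### Convex functions with values in `[0, ∞]` -/

variable {Φ : ℝ≥0 → ℝ≥0∞}

/-! The probabilistic estimates rest on one dichotomy. By the pointwise estimate, off a null set `f`
is Lipschitz with constant `2 * K * c` on the set where the maximal function of `Df` is at most `c`.
If `X` and `X'` both land there, the increment of `f` is controlled by that of the variables. On the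
remaining event, Hölder's inequality between the exponents `q` and `r` costs the probability of the
event to the power `gap q r` (`lintegral_enorm_sub_rpow_le_of_good_set`). It remains to bound that
probability.

For bounded densities the bad set is a superlevel set of the maximal function of the finite measure
`Φ(α|Df|) dx`. The weak type bound controls its volume, and Jensen's inequality on balls
(`maximal_le_genInverse`) bounds the maximal function of `Df` off it by `genInverse Φ t / α`. For
densities in the dual Orlicz space the bad set is a superlevel set of the maximal function of `Df`
itself. Markov, Orlicz–Hölder and the strong type bound make its probability `O(1/t)`, and `t` is
then optimised.

The classical constants are built by hand. The weak type bound is Vitali covering. For the strong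
type bound, convex duality turns `Delta2` for the complementary function into `2 * a * Φ x ≤ Φ (a *
x)` (`IsYoung.exists_nabla2`). This growth makes the sum over the levels `a ^ k` in the layer-cake
argument geometric. The pointwise estimate is proved for mollifications, by averaging over a ball
that lies near both points, with bounds uniform in the mollification parameter. -/

theorem IsYoung.map_mul_le (h : IsYoung Φ) {s : ℝ≥0} (hs : s ≤ 1) (x : ℝ≥0) :
    Φ (s * x) ≤ s * Φ x := by
  have := h.convex.2 (mem_univ x) (mem_univ 0) (zero_le (a := s)) (zero_le (a := 1 - s))
    (add_tsub_cancel_of_le hs)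
  simpa [h.map_zero, ENNReal.smul_def] using this

theorem IsYoung.monotone (h : IsYoung Φ) : Monotone Φ := by
  intro x y hxy
  rcases eq_or_ne y 0 with rfl | hy
  · simp [nonpos_iff_eq_zero.1 hxy]
  have hs : x / y ≤ 1 := div_le_one_of_le₀ hxy zero_le
  calc Φ x = Φ (x / y * y) := by rw [div_mul_cancel₀ _ hy]
    _ ≤ (x / y : ℝ≥0) * Φ y := h.map_mul_le hs y
    _ ≤ 1 * Φ y := by gcongr; exact_mod_cast hs
    _ = Φ y := one_mul _

/-- Supporting lines: the biconjugate of `Φ` is `Φ`. -/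
theorem IsYoung.exists_supporting_line (h : IsYoung Φ) (hc : Continuous Φ) {w m : ℝ≥0}
    (hm : (m : ℝ≥0∞) < Φ w) :
    ∃ x : ℝ≥0, ∀ z : ℝ≥0, (m + x * z : ℝ≥0∞) ≤ Φ z + x * w := by
  -- `Φ w` may be infinite, so the line is taken at a point `v ≤ w` where `Φ` equals `m` exactly.
  -- Continuity keeps `Φ` finite just to the right of `v`, and the slope is nonnegative, so
  -- replacing `v` by `w` at the end only loses.
  obtain ⟨v, hv, hvm⟩ := intermediate_value_Icc (zero_le (a := w)) hc.continuousOn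
    ⟨by simp [h.map_zero], hm.le⟩
  have hvw : v ≤ w := hv.2
  obtain ⟨z₁, hz₁, hvz₁⟩ : ∃ z₁, Φ z₁ < ∞ ∧ v < z₁ := by
    have h1 : ∀ᶠ z in 𝓝[>] v, Φ z < ∞ :=
      (hc.tendsto v).mono_left nhdsWithin_le_nhds |>.eventually_lt_const (by simp [hvm])
    exact (h1.and self_mem_nhdsWithin).exists
  -- Right difference quotients at `v`. Their infimum is the right derivative, which serves as the
  -- slope.
  set S : Set ℝ := {a | ∃ z, Φ z < ∞ ∧ v < z ∧ a = ((Φ z).toReal - m) / (z - v)} with hS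
  have hnonneg : ∀ a ∈ S, 0 ≤ a := by
    rintro _ ⟨z, hz, hvz, rfl⟩
    have h1 : (m : ℝ) ≤ (Φ z).toReal := by
      have := ENNReal.toReal_mono hz.ne (h.monotone hvz.le)
      simpa [hvm] using this
    have h2 : (v : ℝ) ≤ z := by exact_mod_cast hvz.le
    exact div_nonneg (by linarith) (by linarith)
  have hne : S.Nonempty := ⟨_, z₁, hz₁, hvz₁, rfl⟩
  have hx0 : 0 ≤ sInf S := le_csInf hne hnonneg
  have key : ∀ z : ℝ≥0, Φ z < ∞ → (m : ℝ) + sInf S * z ≤ (Φ z).toReal + sInf S * v := by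
    intro z hz
    rcases lt_trichotomy z v with hzv | rfl | hvz
    · have hzv' : (z : ℝ) < v := by exact_mod_cast hzv
      -- To the left of `v`, convexity at the three points `z < v < y` puts every left quotient
      -- below every right one.
      suffices H : (m - (Φ z).toReal) / (v - z) ≤ sInf S by
        rw [div_le_iff₀ (by linarith)] at H
        linarith
      refine le_csInf hne ?_
      rintro _ ⟨y, hy, hvy, rfl⟩
      have hvy' : (v : ℝ) < y := by exact_mod_cast hvy
      have hyz : (0 : ℝ) < y - z := by linarith
      have hpos : z < y := hzv.trans hvy
      have hconv := h.convex.2 (mem_univ z) (mem_univ y)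
        (zero_le (a := (y - v) / (y - z))) (zero_le (a := (v - z) / (y - z))) (by
          have : y - z ≠ 0 := (tsub_pos_of_lt hpos).ne'
          field_simp
          exact tsub_add_tsub_cancel hvy.le hzv.le)
      have hpt : ((y - v) / (y - z)) • z + ((v - z) / (y - z)) • y = v := by
        apply NNReal.coe_injective
        simp only [smul_eq_mul, NNReal.coe_add, NNReal.coe_mul, NNReal.coe_div,
          NNReal.coe_sub hvy.le, NNReal.coe_sub hpos.le, NNReal.coe_sub hzv.le]
        field_simp
        ring
      rw [hpt, hvm] at hconv
      have hreal := ENNReal.toReal_mono (by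
        simp only [ENNReal.smul_def, smul_eq_mul]
        finiteness) hconv
      simp only [ENNReal.smul_def, smul_eq_mul] at hreal
      rw [ENNReal.toReal_add (by finiteness) (by finiteness)] at hreal
      simp only [ENNReal.coe_toReal, ENNReal.toReal_mul, NNReal.coe_div,
          NNReal.coe_sub hvy.le, NNReal.coe_sub hpos.le, NNReal.coe_sub hzv.le] at hreal
      rw [div_mul_eq_mul_div, div_mul_eq_mul_div, ← add_div, le_div_iff₀ hyz] at hreal
      rw [div_le_div_iff₀ (by linarith) (by linarith)]
      nlinarith
    · simp [hvm]
    · have hvz' : (v : ℝ) < z := by exact_mod_cast hvz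
      have H : sInf S ≤ ((Φ z).toReal - m) / (z - v) :=
        csInf_le ⟨0, hnonneg⟩ ⟨z, hz, hvz, rfl⟩
      rw [le_div_iff₀ (by linarith)] at H
      linarith
  obtain ⟨ξ, hξ⟩ : ∃ ξ : ℝ≥0, (ξ : ℝ) = sInf S := ⟨⟨_, hx0⟩, rfl⟩
  rw [← hξ] at key
  refine ⟨ξ, fun z => ?_⟩
  rcases eq_or_ne (Φ z) ∞ with hz | hz
  · simp [hz]
  have hk := key z (lt_top_iff_ne_top.2 hz)
  have hk' : (m : ℝ) + ξ * z ≤ (Φ z).toReal + ξ * w :=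
    hk.trans (by gcongr)
  have e : Φ z = ((Φ z).toNNReal : ℝ≥0∞) := (ENNReal.coe_toNNReal hz).symm
  rw [e]
  have hk'' : m + ξ * z ≤ (Φ z).toNNReal + ξ * w := hk'
  exact_mod_cast hk''

/-- Young's inequality. -/
theorem mul_le_add_complementary (Φ : ℝ≥0 → ℝ≥0∞) (x y : ℝ≥0) :
    (x * y : ℝ≥0∞) ≤ Φ x + complementary Φ y := by
  rw [← tsub_le_iff_left]
  exact le_iSup (fun x : ℝ≥0 => (x : ℝ≥0∞) * y - Φ x) x

theorem complementary_le_iff {c : ℝ≥0∞} {y : ℝ≥0} :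
    complementary Φ y ≤ c ↔ ∀ x : ℝ≥0, (x * y : ℝ≥0∞) ≤ Φ x + c := by
  simp only [complementary, iSup_le_iff, tsub_le_iff_left]

/-- This consequence of convexity, obtained directly from Young's inequality, suffices to show that
Luxemburg norms for the complementary function are finite. -/
theorem complementary_mul_le {s : ℝ≥0} (hs : s ≤ 1) (y : ℝ≥0) :
    complementary Φ (s * y) ≤ s * complementary Φ y := by
  rw [complementary_le_iff]
  intro x
  calc (x * (s * y : ℝ≥0) : ℝ≥0∞) = s * (x * y) := by push_cast; ring
    _ ≤ s * (Φ x + complementary Φ y) := by gcongr; exact mul_le_add_complementary Φ x y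
    _ = s * Φ x + s * complementary Φ y := mul_add _ _ _
    _ ≤ 1 * Φ x + s * complementary Φ y := by gcongr; exact_mod_cast hs
    _ = _ := by rw [one_mul]

theorem complementary_mono : Monotone (complementary Φ) := by
  intro x y hxy
  rw [complementary_le_iff]
  intro z
  exact le_trans (by gcongr) (mul_le_add_complementary Φ z y)

/-- If the complementary function satisfies the `Δ₂`-condition, then `Φ` satisfies the
`∇₂`-condition. -/
theorem IsYoung.exists_nabla2 (h : IsYoung Φ) (hc : Continuous Φ)
    (hΨ : Delta2 (complementary Φ)) :
    ∃ a : ℝ≥0, 2 ≤ a ∧ ∀ x, 2 * a * Φ x ≤ Φ (a * x) := by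
  obtain ⟨C, -, hC⟩ := hΨ
  -- Chosen so that `2 * a` dominates the doubling constant `C` while `a ≥ 2`.
  refine ⟨max C 4 / 2, ?_, fun x => ?_⟩
  · rw [le_div_iff₀ (by norm_num)]
    exact le_trans (by norm_num) (le_max_right _ _)
  set a := max C 4 / 2 with ha
  have h2a : (2 * a : ℝ≥0) = max C 4 := by rw [ha]; field_simp
  have ha0 : a ≠ 0 := by rw [ha]; positivity
  have hC' : ∀ y, complementary Φ (2 * y) ≤ 2 * a * complementary Φ y := by
    intro y
    rcases eq_or_ne y 0 with rfl | hy
    · simp [complementary]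
    · refine (hC y (pos_iff_ne_zero.2 hy)).trans ?_
      gcongr
      calc (C : ℝ≥0∞) ≤ (max C 4 : ℝ≥0) := by exact_mod_cast le_max_left _ _
        _ = 2 * a := by rw [← h2a]; push_cast; rfl
  have hne : (2 * a : ℝ≥0∞) ≠ 0 := by simpa using ha0
  have hnt : (2 * a : ℝ≥0∞) ≠ ∞ := by finiteness
  rw [mul_comm, ← ENNReal.le_div_iff_mul_le (.inl hne) (.inl hnt)]
  refine ENNReal.le_of_forall_nnreal_lt fun m hm => ?_
  obtain ⟨ξ, hξ⟩ := h.exists_supporting_line hc hm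
  -- The supporting line gives near-equality in Young's inequality at `(x, ξ)`. Multiplying by `2 *
  -- a`, writing `2 * a * (ξ * x)` as `(a * x) * (2 * ξ)` and applying Young again moves the
  -- doubling of the complementary function onto `Φ`.
  have h1 : m + complementary Φ ξ ≤ ξ * x := by
    have hm' : (m : ℝ≥0∞) ≤ ξ * x := by simpa [h.map_zero] using hξ 0
    have : complementary Φ ξ ≤ ξ * x - m := by
      rw [complementary_le_iff]
      intro z
      have h2 : (m : ℝ≥0∞) + z * ξ ≤ m + (Φ z + (ξ * x - m)) := by
        calc (m : ℝ≥0∞) + z * ξ = m + ξ * z := by rw [mul_comm (z : ℝ≥0∞)]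
          _ ≤ Φ z + ξ * x := hξ z
          _ = Φ z + (m + (ξ * x - m)) := by rw [add_tsub_cancel_of_le hm']
          _ = _ := by ring
      exact (ENNReal.add_le_add_iff_left ENNReal.coe_ne_top).1 h2
    calc m + complementary Φ ξ ≤ m + (ξ * x - m) := by gcongr
      _ = ξ * x := add_tsub_cancel_of_le hm'
  have hfin : complementary Φ ξ ≠ ∞ :=
    ne_top_of_le_ne_top (b := (ξ * x : ℝ≥0∞)) (by finiteness) (le_add_self.trans h1)
  rw [ENNReal.le_div_iff_mul_le (.inl hne) (.inl hnt)]
  have h2 : (m * (2 * a) : ℝ≥0∞) + 2 * a * complementary Φ ξ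
      ≤ Φ (a * x) + 2 * a * complementary Φ ξ := by
    calc (m * (2 * a) : ℝ≥0∞) + 2 * a * complementary Φ ξ
        = 2 * a * (m + complementary Φ ξ) := by ring
      _ ≤ 2 * a * (ξ * x) := by gcongr
      _ = (a * x : ℝ≥0) * (2 * ξ : ℝ≥0) := by push_cast; ring
      _ ≤ Φ (a * x) + complementary Φ (2 * ξ) := mul_le_add_complementary _ _ _
      _ ≤ _ := by gcongr; exact hC' ξ
  exact (ENNReal.add_le_add_iff_right (by finiteness)).1 h2

theorem nabla2_iterate {a : ℝ≥0} (ha : ∀ x, 2 * a * Φ x ≤ Φ (a * x)) (n : ℕ) (x : ℝ≥0) :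
    (2 * a : ℝ≥0∞) ^ n * Φ x ≤ Φ (a ^ n * x) := by
  induction n with
  | zero => simp
  | succ n ih =>
    calc (2 * a : ℝ≥0∞) ^ (n + 1) * Φ x = 2 * a * ((2 * a) ^ n * Φ x) := by ring
      _ ≤ 2 * a * Φ (a ^ n * x) := by gcongr
      _ ≤ Φ (a * (a ^ n * x)) := ha _
      _ = _ := by rw [pow_succ', mul_assoc]

/-! ### Extension to `[0, ∞]`, modulars and Luxemburg norms -/

@[simp] theorem extend_coe (Φ : ℝ≥0 → ℝ≥0∞) (x : ℝ≥0) : extend Φ x = Φ x := by simp [extend]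

@[simp] theorem extend_top (Φ : ℝ≥0 → ℝ≥0∞) : extend Φ ∞ = ∞ := by simp [extend]

theorem extend_mono (h : Monotone Φ) : Monotone (extend Φ) := by
  intro x y hxy
  induction y with
  | top => simp
  | coe y =>
    lift x to ℝ≥0 using ne_top_of_le_ne_top ENNReal.coe_ne_top hxy
    simpa using h (by exact_mod_cast hxy)

theorem measurable_extend (h : Monotone Φ) : Measurable (extend Φ) := (extend_mono h).measurable

theorem extend_mul_le (h : ∀ s : ℝ≥0, s ≤ 1 → ∀ x, Φ (s * x) ≤ s * Φ x) {s : ℝ≥0} (hs : s ≤ 1)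
    (hs0 : s ≠ 0) (x : ℝ≥0∞) : extend Φ (s * x) ≤ s * extend Φ x := by
  induction x with
  | top => simp [ENNReal.mul_top, hs0]
  | coe x => simpa [← ENNReal.coe_mul] using h s hs x

theorem modular_mul_le {d : ℕ} (h : ∀ s : ℝ≥0, s ≤ 1 → ∀ x, Φ (s * x) ≤ s * Φ x) {s : ℝ≥0}
    (hs : s ≤ 1) (hs0 : s ≠ 0) (u : Rd d → ℝ≥0∞) :
    modular Φ (fun x => s * u x) ≤ s * modular Φ u := by
  rw [modular, modular, ← lintegral_const_mul' _ _ ENNReal.coe_ne_top]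
  exact lintegral_mono fun x => extend_mul_le h hs hs0 _

theorem MemOrlicz.luxNorm_lt_top {d : ℕ} (h : ∀ s : ℝ≥0, s ≤ 1 → ∀ x, Φ (s * x) ≤ s * Φ x)
    {u : Rd d → ℝ≥0∞} (hu : MemOrlicz Φ u) : luxNorm Φ u < ∞ := by
  obtain ⟨-, α, hα, hfin⟩ := hu
  set m := (modular Φ fun x => α * u x).toNNReal with hm
  have hm' : modular Φ (fun x => α * u x) = m := (ENNReal.coe_toNNReal hfin.ne).symm
  -- Shrinking the argument by `s ≤ 1` shrinks the modular at least as much, bringing it below `1`.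
  set s : ℝ≥0 := (max m 1)⁻¹ with hs
  have hs0 : s ≠ 0 := by positivity
  have hs1 : s ≤ 1 := inv_le_one_of_one_le₀ (le_max_right _ _)
  have hle : modular Φ (fun x => u x / ((s * α)⁻¹ : ℝ≥0)) ≤ 1 := by
    calc modular Φ (fun x => u x / ((s * α)⁻¹ : ℝ≥0))
        = modular Φ (fun x => s * (α * u x)) := by
          congr 1; ext x
          rw [ENNReal.coe_inv (by positivity), div_eq_mul_inv, inv_inv]; push_cast; ring
      _ ≤ s * m := by rw [← hm']; exact modular_mul_le h hs1 hs0 _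
      _ ≤ 1 := by
        rw [hs]; norm_cast
        rw [← div_eq_inv_mul]
        exact div_le_one_of_le₀ (le_max_left _ _) zero_le
  refine lt_of_le_of_lt (iInf₂_le (s * α)⁻¹ ⟨by positivity, hle⟩) ENNReal.coe_lt_top

/-- Passes to the infimum over admissible `t`, which need not be attained. The side conditions
exclude the product `0 * ∞`. -/
theorem le_mul_luxNorm {d : ℕ} {u : Rd d → ℝ≥0∞} {b c : ℝ≥0∞} (hc : c ≠ ∞)
    (hc' : c ≠ 0 ∨ luxNorm Φ u ≠ ∞)
    (h : ∀ t : ℝ≥0, (0 < t ∧ modular Φ (fun x => u x / t) ≤ 1) → b ≤ c * t) :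
    b ≤ c * luxNorm Φ u := by
  rw [mul_comm, ← ENNReal.div_le_iff_le_mul hc' (.inl hc)]
  exact le_iInf₂ fun t ht => ENNReal.div_le_of_le_mul' (h t ht)

/-- Hölder's inequality in Orlicz spaces. -/
theorem lintegral_mul_le_luxNorm {d : ℕ} {u v : Rd d → ℝ≥0∞} (hv : AEMeasurable v)
    (hu_fin : luxNorm Φ u ≠ ∞) (hv_fin : luxNorm (complementary Φ) v ≠ ∞) :
    ∫⁻ x, u x * v x ≤ 2 * luxNorm Φ u * luxNorm (complementary Φ) v := by
  have key : ∀ t s : ℝ≥0, (0 < t ∧ modular Φ (fun x => u x / t) ≤ 1) →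
      (0 < s ∧ modular (complementary Φ) (fun x => v x / s) ≤ 1) →
      ∫⁻ x, u x * v x ≤ 2 * t * s := by
    rintro t s ⟨ht, hut⟩ ⟨hs, hvs⟩
    have hpt : ∀ x y : ℝ≥0∞, x * y ≤ extend Φ x + extend (complementary Φ) y := by
      intro x y
      induction x with
      | top => simp
      | coe x =>
        induction y with
        | top => simp
        | coe y => simpa using mul_le_add_complementary Φ x y
    have ht' : (t : ℝ≥0∞) ≠ 0 := by simpa using ht.ne'
    have hs' : (s : ℝ≥0∞) ≠ 0 := by simpa using hs.ne'
    calc ∫⁻ x, u x * v x = ∫⁻ x, (t * s) * (u x / t * (v x / s)) := by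
          refine lintegral_congr fun x => ?_
          calc u x * v x = (u x / t * t) * (v x / s * s) := by
                rw [ENNReal.div_mul_cancel ht' (by simp), ENNReal.div_mul_cancel hs' (by simp)]
            _ = _ := by ring
      _ = t * s * ∫⁻ x, u x / t * (v x / s) := lintegral_const_mul' _ _ (by finiteness)
      _ ≤ t * s * ∫⁻ x, (extend Φ (u x / t) + extend (complementary Φ) (v x / s)) := by
          gcongr with x; exact hpt _ _
      _ = t * s * (modular Φ (fun x => u x / t)
            + modular (complementary Φ) (fun x => v x / s)) := by
          congr 1
          exact lintegral_add_right' _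
            ((measurable_extend complementary_mono).comp_aemeasurable (hv.div_const _))
      _ ≤ t * s * (1 + 1) := by gcongr
      _ = 2 * t * s := by ring
  refine le_mul_luxNorm (by finiteness) (.inr hv_fin) fun s hs => ?_
  rw [mul_right_comm]
  refine le_mul_luxNorm (by finiteness) (.inr hu_fin) fun t ht => ?_
  rw [mul_right_comm]
  exact key t s ht hs

end OrliczAvikainen

namespace OrliczAvikainen

/-! ### The Hardy–Littlewood maximal function -/

variable {d : ℕ}

theorem volume_closedBall_mul (x y : Rd d) {c : ℝ≥0} (hc : 0 < c) (s : ℝ) :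
    volume (Metric.closedBall x (c * s)) = (c : ℝ≥0∞) ^ d * volume (Metric.closedBall y s) := by
  rw [Measure.addHaar_closedBall_mul_of_pos volume x (by exact_mod_cast hc),
    ← Measure.addHaar_closedBall_center volume y, finrank_euclideanSpace_fin,
    ENNReal.ofReal_pow c.coe_nonneg, ENNReal.ofReal_coe_nnreal]

theorem volume_closedBall_ne_zero (x : Rd d) {s : ℝ} (hs : 0 < s) :
    volume (Metric.closedBall x s) ≠ 0 := (Metric.measure_closedBall_pos _ _ hs).ne'

theorem volume_closedBall_ne_top (x : Rd d) (s : ℝ) :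
    volume (Metric.closedBall x s) ≠ ∞ := measure_closedBall_lt_top.ne

theorem lt_maximal_iff {ν : Measure (Rd d)} {x : Rd d} {t : ℝ≥0∞} :
    t < maximal ν x ↔
      ∃ s, 0 < s ∧ t * volume (Metric.closedBall x s) < ν (Metric.closedBall x s) := by
  simp only [maximal, lt_iSup_iff, exists_prop]
  refine exists_congr fun s => and_congr_right fun hs => ?_
  exact ENNReal.lt_div_iff_mul_lt (.inl (volume_closedBall_ne_zero x hs))
    (.inl (volume_closedBall_ne_top x s))

theorem maximal_le_iff {ν : Measure (Rd d)} {x : Rd d} {t : ℝ≥0∞} :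
    maximal ν x ≤ t ↔
      ∀ s, 0 < s → ν (Metric.closedBall x s) ≤ t * volume (Metric.closedBall x s) := by
  rw [← not_lt, lt_maximal_iff]
  simp

/-- A strict inequality on a ball survives a slight dilation by `c > 1`, and the dilated ball about
any nearby centre contains the original one. -/
theorem isOpen_lt_maximal (ν : Measure (Rd d)) (t : ℝ≥0∞) : IsOpen {x | t < maximal ν x} := by
  rw [Metric.isOpen_iff]
  intro x hx
  obtain ⟨s, hs, hlt⟩ := lt_maximal_iff.1 hx
  rcases eq_or_ne t ∞ with rfl | ht
  · simp at hx
  have hcont : Tendsto (fun c : ℝ≥0 => t * ((c : ℝ≥0∞) ^ d * volume (Metric.closedBall x s)))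
      (𝓝[>] 1) (𝓝 (t * (((1 : ℝ≥0) : ℝ≥0∞) ^ d * volume (Metric.closedBall x s)))) := by
    refine Tendsto.mono_left ?_ nhdsWithin_le_nhds
    refine ENNReal.Tendsto.const_mul ?_ (.inr ht)
    refine ENNReal.Tendsto.mul_const ?_ (.inr (volume_closedBall_ne_top x s))
    exact ENNReal.Tendsto.pow (ENNReal.tendsto_coe.2 tendsto_id)
  simp only [ENNReal.coe_one, one_pow, one_mul] at hcont
  obtain ⟨c, hc, hc1⟩ := ((hcont.eventually_lt_const hlt).and self_mem_nhdsWithin).exists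
  have hc1' : (1 : ℝ) < c := by exact_mod_cast hc1
  refine ⟨(c - 1) * s, mul_pos (by linarith) hs, fun y hy => ?_⟩
  refine lt_maximal_iff.2 ⟨c * s, by positivity, ?_⟩
  rw [volume_closedBall_mul y x (by positivity)]
  refine hc.trans_le (measure_mono (Metric.closedBall_subset_closedBall' ?_))
  rw [Metric.mem_ball, dist_comm] at hy
  linarith

theorem measurable_maximal (ν : Measure (Rd d)) : Measurable (maximal ν) :=
  measurable_of_Ioi fun t => (isOpen_lt_maximal ν t).measurableSet

theorem maximal_smul (c : ℝ≥0∞) (ν : Measure (Rd d)) (x : Rd d) :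
    maximal (c • ν) x = c * maximal ν x := by
  simp only [maximal, ENNReal.mul_iSup, Measure.smul_apply, smul_eq_mul, mul_div_assoc]

theorem maximalRestricted_le_maximal (R : ℝ) (ν : Measure (Rd d)) (x : Rd d) :
    maximalRestricted R ν x ≤ maximal ν x :=
  iSup_mono fun _ => iSup_const_mono fun h => h.1

theorem isWeakTypeConst (hd : 0 < d) : IsWeakTypeConst d (5 ^ d) := by
  refine ⟨by positivity, fun ν _ t ht => ?_⟩
  have ht0 : (t : ℝ≥0∞) ≠ 0 := by simpa using ht.ne'
  have hex : ∀ x : Rd d, ∃ s : ℝ, (t : ℝ≥0∞) < maximal ν x → 0 < s ∧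
      t * volume (Metric.closedBall x s) < ν (Metric.closedBall x s) := by
    intro x
    by_cases hx : (t : ℝ≥0∞) < maximal ν x
    · obtain ⟨s, hs⟩ := lt_maximal_iff.1 hx
      exact ⟨s, fun _ => hs⟩
    · exact ⟨0, fun h => absurd h hx⟩
  choose s hs using hex
  set V := volume (Metric.closedBall (0 : Rd d) 1) with hV
  have hV0 : V ≠ 0 := volume_closedBall_ne_zero _ one_pos
  have hVt : V ≠ ∞ := volume_closedBall_ne_top _ _
  -- Vitali's lemma needs bounded radii. Finiteness of `ν` bounds `σ ^ d`, hence `σ` itself once `σ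
  -- > 1`, as `d ≥ 1`.
  have hbd : ∀ x ∈ {x | (t : ℝ≥0∞) < maximal ν x}, s x ≤ max 1 (ν univ / (t * V)).toReal := by
    intro x hx
    obtain ⟨hpos, hlt⟩ := hs x hx
    rw [le_max_iff, or_iff_not_imp_left, not_le]
    intro h1
    lift s x to ℝ≥0 using hpos.le with σ
    have h2 : t * ((σ : ℝ≥0∞) ^ d * V) ≤ ν univ := by
      rw [hV, ← volume_closedBall_mul x 0 (by exact_mod_cast hpos), mul_one]
      exact hlt.le.trans (measure_mono (subset_univ _))
    have h3 : (σ : ℝ≥0∞) ≤ ν univ / (t * V) := by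
      rw [ENNReal.le_div_iff_mul_le (.inl (by simp [ht0, hV0])) (.inl (by finiteness))]
      refine le_trans ?_ h2
      calc (σ : ℝ≥0∞) * (t * V) = t * (σ * V) := by ring
        _ ≤ t * (σ ^ d * V) := by
          gcongr
          exact le_self_pow (by exact_mod_cast h1.le) hd.ne'
    have hfin : ν univ / (t * V) ≠ ∞ :=
      ENNReal.div_ne_top (measure_ne_top _ _) (by simp [ht0, hV0])
    simpa using ENNReal.toReal_mono hfin h3
  obtain ⟨u, hu, hdisj, hcov⟩ := Vitali.exists_disjoint_subfamily_covering_enlargement_closedBall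
    {x | (t : ℝ≥0∞) < maximal ν x} id s _ hbd 5 (by norm_num)
  have hcount : u.Countable := hdisj.countable_of_nonempty_interior fun x hx => by
    refine ⟨x, ?_⟩
    have := Metric.ball_subset_interior_closedBall (x := x) (ε := s x)
    exact this (Metric.mem_ball_self (hs x (hu hx)).1)
  have hsub : {x | (t : ℝ≥0∞) < maximal ν x} ⊆ ⋃ b ∈ u, Metric.closedBall b (5 * s b) := by
    intro x hx
    obtain ⟨b, hb, hxb⟩ := hcov x hx
    exact mem_biUnion hb (hxb (Metric.mem_closedBall_self (hs x hx).1.le))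
  rw [ENNReal.le_div_iff_mul_le (.inl ht0) (.inl ENNReal.coe_ne_top)]
  calc volume {x | (t : ℝ≥0∞) < maximal ν x} * t
      ≤ volume (⋃ b ∈ u, Metric.closedBall b (5 * s b)) * t := by gcongr
    _ ≤ (∑' b : u, volume (Metric.closedBall (b : Rd d) (5 * s b))) * t := by
        gcongr; exact measure_biUnion_le _ hcount _
    _ = ∑' b : u, 5 ^ d * (t * volume (Metric.closedBall (b : Rd d) (s b))) := by
        rw [← ENNReal.tsum_mul_right]
        refine tsum_congr fun b => ?_
        have := volume_closedBall_mul (b : Rd d) b (c := 5) (by norm_num) (s b)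
        push_cast at this
        rw [this]; ring
    _ ≤ ∑' b : u, 5 ^ d * ν (Metric.closedBall (b : Rd d) (s b)) := by
        gcongr with b; exact (hs b (hu b.2)).2.le
    _ = 5 ^ d * ν (⋃ b ∈ u, Metric.closedBall b (s b)) := by
        rw [ENNReal.tsum_mul_left]
        congr 1
        exact (measure_biUnion hcount hdisj
          fun b _ => Metric.isClosed_closedBall.measurableSet).symm
    _ ≤ (5 ^ d : ℝ≥0) * ν univ := by push_cast; gcongr; exact subset_univ _

/-! ### The strong type estimate -/

/-- Cutting `u` at height `t`: the low part contributes at most `t` to any average. -/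
theorem maximal_withDensity_le_add (u : Rd d → ℝ≥0∞) (t : ℝ≥0) (x : Rd d) :
    maximal (volume.withDensity u) x ≤
      maximal (volume.withDensity ({y | (t : ℝ≥0∞) < u y}.indicator u)) x + t := by
  rw [maximal_le_iff]
  intro s hs
  have hB : MeasurableSet (Metric.closedBall x s) := Metric.isClosed_closedBall.measurableSet
  rw [add_mul]
  calc volume.withDensity u (Metric.closedBall x s)
      = ∫⁻ y in Metric.closedBall x s, u y := withDensity_apply _ hB
    _ ≤ ∫⁻ y in Metric.closedBall x s, ({y | (t : ℝ≥0∞) < u y}.indicator u y + t) := by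
        gcongr with y
        by_cases hy : (t : ℝ≥0∞) < u y
        · simp [hy]
        · simpa [hy] using not_lt.1 hy
    _ = volume.withDensity ({y | (t : ℝ≥0∞) < u y}.indicator u) (Metric.closedBall x s)
          + t * volume (Metric.closedBall x s) := by
        rw [lintegral_add_right _ measurable_const, withDensity_apply _ hB, setLIntegral_const]
    _ ≤ _ := by gcongr; exact maximal_le_iff.1 le_rfl s hs

theorem IsWeakTypeConst.volume_lt_maximal_le {A : ℝ≥0} (hA : IsWeakTypeConst d A)
    (u : Rd d → ℝ≥0∞) {t : ℝ≥0} (ht : 0 < t) :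
    volume {x | (2 * t : ℝ≥0∞) < maximal (volume.withDensity u) x} ≤
      A * (∫⁻ y, {y | (t : ℝ≥0∞) < u y}.indicator u y) / t := by
  set w := {y | (t : ℝ≥0∞) < u y}.indicator u
  have ht0 : (t : ℝ≥0∞) ≠ 0 := by simpa using ht.ne'
  rcases eq_or_ne (∫⁻ y, w y) ∞ with h | h
  · rw [h, ENNReal.mul_top (by simpa using hA.1.ne'), ENNReal.top_div_coe]
    exact le_top
  have hfin : IsFiniteMeasure (volume.withDensity w) := isFiniteMeasure_withDensity h
  refine (measure_mono fun x hx => ?_).trans ((hA.2 _ hfin t ht).trans_eq ?_)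
  · have := lt_of_lt_of_le (show (2 * t : ℝ≥0∞) < _ from hx) (maximal_withDensity_le_add u t x)
    rw [two_mul] at this
    exact (ENNReal.add_lt_add_iff_right ENNReal.coe_ne_top).1 this
  · rw [withDensity_apply _ MeasurableSet.univ, setLIntegral_univ]

/-- If `a ^ k < v ≤ a ^ (k + 1)`, the term of index `k` alone suffices. At `v = ∞` the terms are
unbounded. -/
theorem extend_le_tsum {Φ : ℝ≥0 → ℝ≥0∞} (hΦ : IsYoung Φ) {a : ℝ≥0} (ha : 1 < a) (v : ℝ≥0∞) :
    extend Φ v ≤ ∑' k : ℤ, if ((a ^ k : ℝ≥0) : ℝ≥0∞) < v then Φ (a ^ (k + 1)) else 0 := by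
  induction v with
  | top =>
    simp only [extend_top, ENNReal.coe_lt_top, if_true, top_le_iff]
    refine ENNReal.eq_top_of_forall_nnreal_le fun m => ?_
    have h1 : Tendsto (fun n : ℕ => Φ (a ^ n)) atTop (𝓝 ∞) :=
      hΦ.tendsto_top.comp (tendsto_pow_atTop_atTop_of_one_lt ha)
    obtain ⟨n, hn⟩ := (h1.eventually_const_lt (ENNReal.coe_lt_top (r := m))).exists
    refine hn.le.trans (le_trans ?_ (ENNReal.le_tsum ((n : ℤ) - 1)))
    simp
  | coe v =>
    rcases eq_or_ne v 0 with rfl | hv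
    · simp [extend, hΦ.map_zero]
    obtain ⟨k, hk, hk'⟩ := exists_mem_Ioc_zpow (pos_iff_ne_zero.2 hv) ha
    refine le_trans ?_ (ENNReal.le_tsum k)
    rw [if_pos (by exact_mod_cast hk), extend_coe]
    exact hΦ.monotone hk'

/-- Only levels with `a ^ k < 2 * v` contribute. Going `n` levels down divides `Φ` by at least `(2 *
a) ^ n` while `1 / a ^ k` grows only by `a ^ n`, so the terms decay like `2⁻¹ ^ n`, and the factor
`2` is the geometric series. -/
theorem tsum_zpow_le {Φ : ℝ≥0 → ℝ≥0∞} (hΦ : IsYoung Φ) {a : ℝ≥0} (ha2 : 2 ≤ a)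
    (ha : ∀ x, 2 * a * Φ x ≤ Φ (a * x)) (v : ℝ≥0∞) :
    ∑' k : ℤ, Φ (a ^ (k + 1)) *
        (((if ((a ^ k / 2 : ℝ≥0) : ℝ≥0∞) < v then v else 0)) / (a ^ k / 2 : ℝ≥0)) ≤
      2 * extend Φ (2 * a * v) := by
  have ha0 : 0 < a := lt_of_lt_of_le (by norm_num) ha2
  have ha1 : 1 < a := lt_of_lt_of_le (by norm_num) ha2
  induction v with
  | top => simp [ENNReal.mul_top, ha0.ne']
  | coe v =>
  rcases eq_or_ne v 0 with rfl | hv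
  · simp
  have hv0 : 0 < v := pos_iff_ne_zero.2 hv
  obtain ⟨K, hK, hK'⟩ := exists_mem_Ioc_zpow (show 0 < 2 * v by positivity) ha1
  set w : ℤ → ℝ≥0∞ := fun j => if 0 ≤ j then (2 : ℝ≥0∞)⁻¹ ^ j.toNat else 0 with hw
  have hterm : ∀ k : ℤ, Φ (a ^ (k + 1)) *
        (((if ((a ^ k / 2 : ℝ≥0) : ℝ≥0∞) < v then (v : ℝ≥0∞) else 0)) / (a ^ k / 2 : ℝ≥0)) ≤
        w (K - k) * Φ (2 * a * v) := by
    intro k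
    split_ifs with hk
    swap
    · simp
    have hk2 : a ^ k < 2 * v := by
      have : a ^ k / 2 < v := by exact_mod_cast hk
      rwa [div_lt_iff₀ (by norm_num), mul_comm] at this
    have hkK : k ≤ K := by
      have := (zpow_lt_zpow_iff_right₀ ha1).1 (hk2.trans_le hK')
      omega
    obtain ⟨n, hn⟩ := Int.le.dest hkK
    have hwn : w (K - k) = (2 : ℝ≥0∞)⁻¹ ^ n := by
      have : K - k = n := by omega
      simp [hw, this]
    rw [hwn]
    have hkne : a ^ k ≠ 0 := (zpow_pos ha0 k).ne'
    have hs : a ^ n * a ^ (k + 1) ≤ 2 * a * v := by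
      calc a ^ n * a ^ (k + 1) = a * a ^ K := by
            rw [← hn, zpow_add₀ ha0.ne', zpow_add₀ ha0.ne', zpow_natCast, zpow_one]; ring
        _ ≤ a * (2 * v) := by gcongr
        _ = _ := by ring
    have hb : 2 * a * v ≠ 0 := by positivity
    -- Keeping the ratio from convexity, instead of bounding it by `1`, makes the final factor
    -- exactly `2⁻¹ ^ n`.
    have h1 : (2 * a : ℝ≥0∞) ^ n * Φ (a ^ (k + 1)) ≤
        (a ^ n * a ^ (k + 1) / (2 * a * v) : ℝ≥0) * Φ (2 * a * v) := by
      refine (nabla2_iterate ha n _).trans ?_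
      have h2 := hΦ.map_mul_le (div_le_one_of_le₀ hs zero_le) (2 * a * v)
      rwa [div_mul_cancel₀ _ hb] at h2
    have h3 : Φ (a ^ (k + 1)) = ((2 * a)⁻¹ ^ n : ℝ≥0) * ((2 * a : ℝ≥0∞) ^ n * Φ (a ^ (k + 1))) := by
      rw [← mul_assoc]
      have : (((2 * a)⁻¹ ^ n : ℝ≥0) : ℝ≥0∞) * (2 * a : ℝ≥0∞) ^ n = 1 := by
        norm_cast
        rw [← mul_pow, inv_mul_cancel₀ (by positivity), one_pow]
      rw [this, one_mul]
    have h4 : (v : ℝ≥0∞) / (a ^ k / 2 : ℝ≥0) = (v / (a ^ k / 2) : ℝ≥0) :=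
      (ENNReal.coe_div (by positivity)).symm
    rw [h4, h3, show (2 : ℝ≥0∞)⁻¹ ^ n = ((2⁻¹ ^ n : ℝ≥0) : ℝ≥0∞) by push_cast; simp]
    calc (((2 * a)⁻¹ ^ n : ℝ≥0) : ℝ≥0∞) * ((2 * a : ℝ≥0∞) ^ n * Φ (a ^ (k + 1)))
          * (v / (a ^ k / 2) : ℝ≥0)
        ≤ ((2 * a)⁻¹ ^ n : ℝ≥0) * ((a ^ n * a ^ (k + 1) / (2 * a * v) : ℝ≥0) * Φ (2 * a * v))
          * (v / (a ^ k / 2) : ℝ≥0) := by gcongr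
      _ = (((2 * a)⁻¹ ^ n * (a ^ n * a ^ (k + 1) / (2 * a * v)) * (v / (a ^ k / 2)) : ℝ≥0) :
            ℝ≥0∞) * Φ (2 * a * v) := by push_cast; ring
      _ = _ := by
        congr 2
        rw [zpow_add₀ ha0.ne', zpow_one, inv_pow, inv_pow, mul_pow]
        field_simp
  have hsum : ∑' k : ℤ, w (K - k) = 2 := by
    rw [show ∑' k : ℤ, w (K - k) = ∑' k, w k from (Equiv.subLeft K).tsum_eq w, ← Nat.cast_injective.tsum_eq (g := ((↑) : ℕ → ℤ))]
    · simp only [hw, Nat.cast_nonneg, if_true, Int.toNat_natCast]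
      rw [ENNReal.tsum_geometric, ENNReal.one_sub_inv_two, inv_inv]
    · intro j hj
      by_contra hcon
      apply hj
      have : ¬ 0 ≤ j := fun h => hcon ⟨j.toNat, Int.toNat_of_nonneg h⟩
      simp [hw, this]
  calc _ ≤ ∑' k : ℤ, w (K - k) * Φ (2 * a * v) := ENNReal.tsum_le_tsum hterm
    _ = 2 * Φ (2 * a * v) := by rw [ENNReal.tsum_mul_right, hsum]
    _ = _ := by
      have : (2 * a * v : ℝ≥0∞) = (2 * a * v : ℝ≥0) := by push_cast; rfl
      rw [this, extend_coe]

/-- Marcinkiewicz-type interpolation: decompose along the levels `a ^ k`, apply the weak type bound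
to `u` truncated at half of each level, and sum under the integral. -/
theorem IsWeakTypeConst.modular_maximal_le {Φ : ℝ≥0 → ℝ≥0∞} (hΦ : IsYoung Φ) {a : ℝ≥0}
    (ha2 : 2 ≤ a) (ha : ∀ x, 2 * a * Φ x ≤ Φ (a * x)) {A : ℝ≥0} (hA : IsWeakTypeConst d A)
    {u : Rd d → ℝ≥0∞} (hu : Measurable u) :
    modular Φ (maximal (volume.withDensity u)) ≤ 2 * A * modular Φ (fun x => 2 * a * u x) := by
  have ha0 : 0 < a := lt_of_lt_of_le (by norm_num) ha2
  have ha1 : 1 < a := lt_of_lt_of_le (by norm_num) ha2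
  have hset : ∀ t : ℝ≥0∞, MeasurableSet {x | t < maximal (volume.withDensity u) x} :=
    fun t => (isOpen_lt_maximal _ t).measurableSet
  calc modular Φ (maximal (volume.withDensity u))
      ≤ ∫⁻ x, ∑' k : ℤ, if ((a ^ k : ℝ≥0) : ℝ≥0∞) < maximal (volume.withDensity u) x
          then Φ (a ^ (k + 1)) else 0 := lintegral_mono fun x => extend_le_tsum hΦ ha1 _
    _ = ∑' k : ℤ, Φ (a ^ (k + 1)) *
          volume {x | ((a ^ k : ℝ≥0) : ℝ≥0∞) < maximal (volume.withDensity u) x} := by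
        rw [lintegral_tsum fun k =>
          (Measurable.ite (hset _) measurable_const measurable_const).aemeasurable]
        refine tsum_congr fun k => ?_
        rw [← setLIntegral_const, ← lintegral_indicator (hset _)]
        simp only [indicator_apply, mem_ofPred_eq]
    _ ≤ ∑' k : ℤ, Φ (a ^ (k + 1)) * (A *
          (∫⁻ y, {y | ((a ^ k / 2 : ℝ≥0) : ℝ≥0∞) < u y}.indicator u y) / (a ^ k / 2 : ℝ≥0)) := by
        gcongr with k
        have hpos : 0 < a ^ k / 2 := div_pos (zpow_pos ha0 k) (by norm_num)
        refine le_trans (measure_mono ?_) (hA.volume_lt_maximal_le u hpos)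
        intro x hx
        have : (2 * (a ^ k / 2 : ℝ≥0) : ℝ≥0∞) = (a ^ k : ℝ≥0) := by
          norm_cast
          field_simp
        simpa only [mem_ofPred_eq, this] using hx
    _ = A * ∫⁻ y, ∑' k : ℤ, Φ (a ^ (k + 1)) *
          ((if ((a ^ k / 2 : ℝ≥0) : ℝ≥0∞) < u y then u y else 0) / (a ^ k / 2 : ℝ≥0)) := by
        have hm : ∀ k : ℤ, Measurable fun y =>
            (if ((a ^ k / 2 : ℝ≥0) : ℝ≥0∞) < u y then u y else 0) / ((a ^ k / 2 : ℝ≥0) : ℝ≥0∞) :=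
          fun k => (Measurable.ite (measurableSet_lt measurable_const hu) hu
            measurable_const).div_const _
        rw [lintegral_tsum fun k => ((hm k).const_mul _).aemeasurable, ← ENNReal.tsum_mul_left]
        refine tsum_congr fun k => ?_
        rw [lintegral_const_mul _ (hm k)]
        simp_rw [div_eq_mul_inv]
        rw [lintegral_mul_const _ (Measurable.ite (measurableSet_lt measurable_const hu) hu
            measurable_const)]
        have : (fun y => if ((a ^ k / 2 : ℝ≥0) : ℝ≥0∞) < u y then u y else 0) =
          {y | ((a ^ k / 2 : ℝ≥0) : ℝ≥0∞) < u y}.indicator u := by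
          ext y; simp only [indicator_apply, mem_ofPred_eq]
        simp only [div_eq_mul_inv] at this
        rw [this]
        ring
    _ ≤ A * ∫⁻ y, 2 * extend Φ (2 * a * u y) := by
        gcongr with y; exact tsum_zpow_le hΦ ha2 ha _
    _ = _ := by rw [lintegral_const_mul' _ _ (by simp), modular]; ring

theorem exists_isStrongTypeConst {Φ : ℝ≥0 → ℝ≥0∞} (hd : 0 < d) (hΦ : IsYoung Φ)
    (hc : Continuous Φ) (hΨ : Delta2 (complementary Φ)) :
    ∃ A : ℝ≥0, IsStrongTypeConst d Φ A := by
  obtain ⟨a, ha2, ha⟩ := hΦ.exists_nabla2 hc hΨ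
  have ha0 : 0 < a := lt_of_lt_of_le (by norm_num) ha2
  have hA := isWeakTypeConst hd
  set A : ℝ≥0 := 5 ^ d
  set C : ℝ≥0 := max (2 * A) 1 with hC
  have hC0 : 0 < C := lt_of_lt_of_le one_pos (le_max_right _ _)
  -- The factor `2 * a` undoes the dilation inside the modular bound; `C` absorbs its prefactor `2 *
  -- A` by convexity.
  refine ⟨2 * a * C, by positivity, fun f hf _ => ?_⟩
  refine le_mul_luxNorm (by finiteness) (.inl (by simp [ha0.ne', hC0.ne'])) fun t ht => ?_
  set u : Rd d → ℝ≥0∞ := hf.enorm.mk _ with hu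
  have hum : Measurable u := hf.enorm.measurable_mk
  have hfu : (fun x => ‖f x‖ₑ) =ᵐ[volume] u := hf.enorm.ae_eq_mk
  have habs : absMeasure f = volume.withDensity u := withDensity_congr_ae hfu
  have ht0 : 0 < t := ht.1
  set c : ℝ≥0 := (2 * a * t)⁻¹ with hcdef
  have hct : (2 * a * c : ℝ≥0∞) = (t : ℝ≥0∞)⁻¹ := by
    rw [← ENNReal.coe_inv ht0.ne']
    norm_cast
    rw [hcdef]; field_simp
  have hadm : modular Φ (fun x => maximal (absMeasure f) x / (2 * a * C * t : ℝ≥0)) ≤ 1 := by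
    calc modular Φ (fun x => maximal (absMeasure f) x / (2 * a * C * t : ℝ≥0))
        = modular Φ (fun x => (C⁻¹ : ℝ≥0) * maximal (volume.withDensity fun x => c * u x) x) := by
          congr 1; ext x
          have : (volume.withDensity fun x => c * u x) = (c : ℝ≥0∞) • volume.withDensity u :=
            withDensity_smul _ hum
          rw [this, maximal_smul, ← habs, div_eq_mul_inv, mul_comm, ← mul_assoc,
            ← ENNReal.coe_inv (by positivity)]
          congr 1
          norm_cast
          rw [hcdef]; field_simp
      _ ≤ (C⁻¹ : ℝ≥0) * modular Φ (maximal (volume.withDensity fun x => c * u x)) :=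
          modular_mul_le (fun _ => hΦ.map_mul_le) (inv_le_one_of_one_le₀ (le_max_right _ _))
            (by positivity) _
      _ ≤ (C⁻¹ : ℝ≥0) * (2 * A * modular Φ (fun x => 2 * a * (c * u x))) := by
          gcongr; exact hA.modular_maximal_le hΦ ha2 ha (hum.const_mul _)
      _ = (C⁻¹ * (2 * A) : ℝ≥0) * modular Φ (fun x => ‖f x‖ₑ / t) := by
          have : modular Φ (fun x => 2 * a * (c * u x)) = modular Φ (fun x => ‖f x‖ₑ / t) := by
            refine lintegral_congr_ae ?_
            filter_upwards [hfu] with x hx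
            rw [hx, ← mul_assoc, hct, div_eq_mul_inv, mul_comm]
          rw [this]; push_cast; ring
      _ ≤ 1 * 1 := by
          gcongr
          · norm_cast
            rw [← div_eq_inv_mul]
            exact div_le_one_of_le₀ (le_max_left _ _) zero_le
          · exact ht.2
      _ = 1 := one_mul 1
  calc luxNorm Φ (maximal (absMeasure f)) ≤ (2 * a * C * t : ℝ≥0) :=
        iInf₂_le _ ⟨by positivity, hadm⟩
    _ = _ := by push_cast; rfl

end OrliczAvikainen

namespace OrliczAvikainen

open scoped Convolution

/-! ### The pointwise estimate for smooth functions -/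

variable {d : ℕ}

theorem enorm_sub_le_lintegral_fderiv {g : Rd d → ℝ} (hg : ContDiff ℝ 1 g) (v : Rd d) :
    ‖g v - g 0‖ₑ ≤ ∫⁻ t in Ioc (0 : ℝ) 1, ‖fderiv ℝ g (t • v)‖ₑ * ‖v‖ₑ := by
  have hcont : Continuous fun t : ℝ => fderiv ℝ g (t • v) v :=
    ((hg.continuous_fderiv one_ne_zero).comp (continuous_id.smul continuous_const)).clm_apply
      continuous_const
  have hderiv : ∀ t : ℝ, HasDerivAt (fun t : ℝ => g (t • v)) (fderiv ℝ g (t • v) v) t := by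
    intro t
    have h1 : HasDerivAt (fun t : ℝ => t • v) v t := by
      simpa using (hasDerivAt_id t).smul_const v
    exact ((hg.differentiable one_ne_zero _).hasFDerivAt).comp_hasDerivAt t h1
  have h := intervalIntegral.integral_eq_sub_of_hasDerivAt (a := 0) (b := 1)
    (fun t _ => hderiv t) (hcont.intervalIntegrable 0 1)
  simp only [one_smul, zero_smul] at h
  rw [← h, intervalIntegral.integral_of_le zero_le_one]
  refine (enorm_integral_le_lintegral_enorm _).trans (lintegral_mono fun t => ?_)
  exact ContinuousLinearMap.le_opENorm _ _

/-- Integrate the fundamental theorem of calculus along rays over the ball and exchange the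
integrals. The dilation `v ↦ t • v` turns each inner integral into one over the ball of radius `t *
r`, and the Jacobian cancels the change of volume. -/
theorem lintegral_enorm_sub_zero_le {g : Rd d → ℝ} (hg : ContDiff ℝ 1 g) {r : ℝ} (hr : 0 < r)
    {D : ℝ≥0∞} (hD : ∀ s, 0 < s → s ≤ r → ∫⁻ z in Metric.closedBall (0 : Rd d) s, ‖fderiv ℝ g z‖ₑ ≤
      D * volume (Metric.closedBall (0 : Rd d) s)) :
    ∫⁻ v in Metric.closedBall (0 : Rd d) r, ‖g v - g 0‖ₑ ≤
      ENNReal.ofReal r * D * volume (Metric.closedBall (0 : Rd d) r) := by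
  set h : Rd d → ℝ≥0∞ := fun z => ‖fderiv ℝ g z‖ₑ with hh
  have hhc : Continuous h := (hg.continuous_fderiv one_ne_zero).enorm
  have hscale : ∀ t : ℝ, t ∈ Ioc (0 : ℝ) 1 → ∫⁻ v in Metric.closedBall (0 : Rd d) r, h (t • v) ≤
      D * volume (Metric.closedBall (0 : Rd d) r) := by
    intro t ht
    have hpre : (fun v : Rd d => t • v) ⁻¹' Metric.closedBall 0 (t * r)
        = Metric.closedBall 0 r := by
      ext v
      simp only [mem_preimage, mem_closedBall_zero_iff, norm_smul, Real.norm_eq_abs,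
        abs_of_pos ht.1]
      exact mul_le_mul_iff_right₀ ht.1
    have hmap := setLIntegral_map (μ := (volume : Measure (Rd d))) (f := h)
      (Metric.isClosed_closedBall (x := (0 : Rd d)) (ε := t * r)).measurableSet
      hhc.measurable (measurable_const_smul t)
    rw [hpre, Measure.map_addHaar_smul _ ht.1.ne', Measure.restrict_smul, lintegral_smul_measure,
      finrank_euclideanSpace_fin] at hmap
    obtain ⟨c, rfl⟩ : ∃ c : ℝ≥0, (c : ℝ) = t := ⟨⟨t, ht.1.le⟩, rfl⟩
    have hvol := volume_closedBall_mul (0 : Rd d) 0 (c := c) (by exact_mod_cast ht.1) r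
    have hc : ENNReal.ofReal |((c : ℝ) ^ d)⁻¹| * (c : ℝ≥0∞) ^ d = 1 := by
      have h1 := pow_pos ht.1 d
      rw [← ENNReal.ofReal_coe_nnreal, ← ENNReal.ofReal_pow ht.1.le,
        ← ENNReal.ofReal_mul (abs_nonneg _), abs_of_pos (inv_pos.2 h1), inv_mul_cancel₀ h1.ne',
        ENNReal.ofReal_one]
    calc ∫⁻ v in Metric.closedBall (0 : Rd d) r, h ((c : ℝ) • v)
        = ENNReal.ofReal |((c : ℝ) ^ d)⁻¹| * ∫⁻ y in Metric.closedBall 0 (c * r), h y := hmap.symm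
      _ ≤ ENNReal.ofReal |((c : ℝ) ^ d)⁻¹| * (D * volume (Metric.closedBall (0 : Rd d) (c * r))) := by
          gcongr
          exact hD _ (mul_pos ht.1 hr) (mul_le_of_le_one_left hr.le ht.2)
      _ = (ENNReal.ofReal |((c : ℝ) ^ d)⁻¹| * (c : ℝ≥0∞) ^ d) *
            (D * volume (Metric.closedBall (0 : Rd d) r)) := by rw [hvol]; ring
      _ = _ := by rw [hc, one_mul]
  calc ∫⁻ v in Metric.closedBall (0 : Rd d) r, ‖g v - g 0‖ₑ
      ≤ ∫⁻ v in Metric.closedBall (0 : Rd d) r,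
          ENNReal.ofReal r * ∫⁻ t in Ioc (0 : ℝ) 1, h (t • v) := by
        refine setLIntegral_mono' Metric.isClosed_closedBall.measurableSet fun v hv => ?_
        refine (enorm_sub_le_lintegral_fderiv hg v).trans ?_
        rw [lintegral_mul_const' _ _ (by finiteness), mul_comm]
        gcongr
        rw [← ofReal_norm]
        exact ENNReal.ofReal_le_ofReal (mem_closedBall_zero_iff.1 hv)
    _ = ENNReal.ofReal r * ∫⁻ t in Ioc (0 : ℝ) 1,
          ∫⁻ v in Metric.closedBall (0 : Rd d) r, h (t • v) := by
        rw [lintegral_const_mul' _ _ (by finiteness), lintegral_lintegral_swap]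
        exact (hhc.comp (continuous_snd.smul continuous_fst)).measurable.aemeasurable
    _ ≤ ENNReal.ofReal r * ∫⁻ t in Ioc (0 : ℝ) 1, D * volume (Metric.closedBall (0 : Rd d) r) := by
        gcongr 1
        exact setLIntegral_mono' measurableSet_Ioc hscale
    _ = _ := by simp [mul_assoc]

theorem setLIntegral_closedBall_add_left (x : Rd d) (s : ℝ) (h : Rd d → ℝ≥0∞) :
    ∫⁻ v in Metric.closedBall (0 : Rd d) s, h (x + v) = ∫⁻ z in Metric.closedBall x s, h z := by
  have := (measurePreserving_add_left (volume : Measure (Rd d)) x).setLIntegral_comp_preimage_emb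
    (measurableEmbedding_addLeft x) h (Metric.closedBall x s)
  rwa [preimage_add_closedBall, sub_self] at this

theorem lintegral_enorm_sub_le {g : Rd d → ℝ} (hg : ContDiff ℝ 1 g) (x : Rd d) {r : ℝ} (hr : 0 < r)
    {D : ℝ≥0∞} (hD : ∀ s, 0 < s → s ≤ r → ∫⁻ z in Metric.closedBall x s, ‖fderiv ℝ g z‖ₑ ≤
      D * volume (Metric.closedBall x s)) :
    ∫⁻ v in Metric.closedBall x r, ‖g v - g x‖ₑ ≤
      ENNReal.ofReal r * D * volume (Metric.closedBall x r) := by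
  have hg' : ContDiff ℝ 1 (fun v => g (x + v)) := hg.comp (contDiff_const.add contDiff_id)
  have := lintegral_enorm_sub_zero_le hg' hr (D := D) fun s hs hsr => by
    simp only [fderiv_comp_add_left]
    rw [setLIntegral_closedBall_add_left x s fun z => ‖fderiv ℝ g z‖ₑ,
      ← Measure.addHaar_closedBall_center volume x]
    exact hD s hs hsr
  simp only [add_zero] at this
  rwa [setLIntegral_closedBall_add_left x r fun z => ‖g z - g x‖ₑ,
    ← Measure.addHaar_closedBall_center volume x] at this

/-- The ball of radius `r / 2` about the midpoint lies in the `r`-balls about both points. Averaging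
the triangle inequality over it costs the volume ratio `2 ^ d`. -/
theorem enorm_sub_le_of_fderiv_average_le {g : Rd d → ℝ} (hg : ContDiff ℝ 1 g) {x y : Rd d}
    (hxy : x ≠ y) {Dx Dy : ℝ≥0∞}
    (hx : ∀ s, 0 < s → s ≤ ‖x - y‖ → ∫⁻ z in Metric.closedBall x s, ‖fderiv ℝ g z‖ₑ ≤
      Dx * volume (Metric.closedBall x s))
    (hy : ∀ s, 0 < s → s ≤ ‖x - y‖ → ∫⁻ z in Metric.closedBall y s, ‖fderiv ℝ g z‖ₑ ≤
      Dy * volume (Metric.closedBall y s)) :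
    ‖g x - g y‖ₑ ≤ 2 ^ d * ‖x - y‖ₑ * (Dx + Dy) := by
  set r := ‖x - y‖ with hr
  have hr0 : 0 < r := norm_pos_iff.2 (sub_ne_zero.2 hxy)
  set m := midpoint ℝ x y with hm
  set B := Metric.closedBall m (r / 2)
  have hBx : B ⊆ Metric.closedBall x r := Metric.closedBall_subset_closedBall' (by
    rw [hm, dist_midpoint_left, dist_eq_norm, Real.norm_eq_abs, abs_of_pos two_pos, ← hr]
    linarith)
  have hBy : B ⊆ Metric.closedBall y r := Metric.closedBall_subset_closedBall' (by
    rw [hm, dist_midpoint_right, dist_eq_norm, Real.norm_eq_abs, abs_of_pos two_pos, ← hr]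
    linarith)
  have hB0 : volume B ≠ 0 := volume_closedBall_ne_zero _ (by positivity)
  have hBt : volume B ≠ ∞ := volume_closedBall_ne_top _ _
  have hvol : ∀ z : Rd d, volume (Metric.closedBall z r) = 2 ^ d * volume B := by
    intro z
    have := volume_closedBall_mul z m (c := 2) two_pos (r / 2)
    rwa [NNReal.coe_ofNat, mul_div_cancel₀ r two_ne_zero] at this
  have key : ‖g x - g y‖ₑ * volume B ≤ 2 ^ d * ‖x - y‖ₑ * (Dx + Dy) * volume B := by
    calc ‖g x - g y‖ₑ * volume B = ∫⁻ z in B, ‖g x - g y‖ₑ := by rw [setLIntegral_const]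
      _ ≤ ∫⁻ z in B, (‖g z - g x‖ₑ + ‖g z - g y‖ₑ) := by
          gcongr with z
          rw [show g x - g y = (g z - g y) - (g z - g x) by ring, add_comm]
          exact enorm_sub_le
      _ = (∫⁻ z in B, ‖g z - g x‖ₑ) + ∫⁻ z in B, ‖g z - g y‖ₑ :=
          lintegral_add_left (hg.continuous.sub continuous_const).enorm.measurable _
      _ ≤ (∫⁻ z in Metric.closedBall x r, ‖g z - g x‖ₑ)
            + ∫⁻ z in Metric.closedBall y r, ‖g z - g y‖ₑ :=
          add_le_add (lintegral_mono_set hBx) (lintegral_mono_set hBy)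
      _ ≤ ENNReal.ofReal r * Dx * volume (Metric.closedBall x r)
            + ENNReal.ofReal r * Dy * volume (Metric.closedBall y r) := by
          gcongr
          · exact lintegral_enorm_sub_le hg x hr0 hx
          · exact lintegral_enorm_sub_le hg y hr0 hy
      _ = _ := by rw [hvol, hvol, hr, ofReal_norm]; ring
  exact (ENNReal.mul_le_mul_iff_left hB0 hBt).1 key

/-! ### Mollification -/

/-- Testing the weak gradient against `y ↦ ψ (x - y)` shows that the gradient of the mollification
is the mollified gradient; the sign from reflecting `ψ` cancels the one from integrating by parts.
-/
theorem HasWeakGradient.enorm_fderiv_convolution_le {f : Rd d → ℝ} {G : Rd d → Rd d}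
    (h : HasWeakGradient f G) {ψ : Rd d → ℝ} (hψ : ContDiff ℝ (⊤ : ℕ∞) ψ)
    (hψc : HasCompactSupport ψ) (hψ0 : ∀ x, 0 ≤ ψ x) (x : Rd d) :
    ‖fderiv ℝ (f ⋆[(ContinuousLinearMap.lsmul ℝ ℝ).flip, volume] ψ) x‖ₑ ≤
      ∫⁻ y, ENNReal.ofReal (ψ (x - y)) * ‖G y‖ₑ := by
  have hψ1 : ContDiff ℝ 1 ψ := hψ.of_le (by exact_mod_cast le_top)
  have hshift : ContDiff ℝ (⊤ : ℕ∞) fun y => ψ (x - y) := hψ.comp (contDiff_const.sub contDiff_id)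
  have hshiftc : HasCompactSupport fun y => ψ (x - y) :=
    hψc.comp_homeomorph (Homeomorph.subLeft x)
  set W : Rd d := ∫ y, ψ (x - y) • G y with hW
  have hint : Integrable fun y => ψ (x - y) • G y :=
    h.locallyIntegrable_grad.integrable_smul_left_of_hasCompactSupport hshift.continuous hshiftc
  have hbasis : ∀ i, fderiv ℝ (f ⋆[(ContinuousLinearMap.lsmul ℝ ℝ).flip, volume] ψ) x
      (EuclideanSpace.single i 1) = W i := by
    intro i
    rw [(hψc.hasFDerivAt_convolution_right _ h.locallyIntegrable hψ1 x).fderiv,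
      convolution_precompR_apply _ h.locallyIntegrable (hψc.fderiv ℝ)
        (hψ1.continuous_fderiv one_ne_zero)]
    have h1 := h.integral_eq _ hshift hshiftc i
    have h2 : ∀ y, fderiv ℝ (fun y => ψ (x - y)) y (EuclideanSpace.single i 1) =
        - fderiv ℝ ψ (x - y) (EuclideanSpace.single i 1) := by
      intro y
      have := ((hψ1.differentiable one_ne_zero (x - y)).hasFDerivAt.comp y
        ((hasFDerivAt_id y).const_sub x)).fderiv
      rw [show (fun y => ψ (x - y)) = ψ ∘ HSub.hSub x from rfl, this]
      simp
    simp only [h2, mul_neg, integral_neg, neg_inj] at h1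
    have h3 : W i = ∫ y, G y i * ψ (x - y) := by
      have := (EuclideanSpace.proj (𝕜 := ℝ) i).integral_comp_comm hint
      rw [hW]
      simp only [PiLp.proj_apply, PiLp.smul_apply, smul_eq_mul] at this
      rw [← this]
      exact integral_congr_ae (.of_forall fun y => mul_comm _ _)
    rw [h3, ← h1, convolution_def]
    refine integral_congr_ae (.of_forall fun y => ?_)
    simp [mul_comm]
  have hinner : fderiv ℝ (f ⋆[(ContinuousLinearMap.lsmul ℝ ℝ).flip, volume] ψ) x
      = innerSL ℝ W := by
    refine ContinuousLinearMap.coe_injective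
      ((EuclideanSpace.basisFun (Fin d) ℝ).toBasis.ext fun i => ?_)
    simp [hbasis, EuclideanSpace.inner_single_right]
  rw [hinner]
  calc ‖innerSL ℝ W‖ₑ = ‖W‖ₑ := by
        rw [← ofReal_norm, innerSL_apply_norm, ofReal_norm]
    _ ≤ ∫⁻ y, ‖ψ (x - y) • G y‖ₑ := enorm_integral_le_lintegral_enorm _
    _ = _ := by
        refine lintegral_congr fun y => ?_
        rw [enorm_smul, Real.enorm_of_nonneg (hψ0 _)]

/-- Mollifying at scale `ε` moves mass by at most `ε`. If `ε ≤ s`, the mass in the `s`-ball comes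
from the `2 * s`-ball. If `s < ε`, the kernel is at most `2 ^ d` over the volume of an `ε`-ball, and
only the `2 * ε`-ball matters. Both radii stay within `2 * r`, hence the restriction radius. -/
theorem setLIntegral_mollified_le {u : Rd d → ℝ≥0∞} (hu : AEMeasurable u)
    (φ : ContDiffBump (0 : Rd d)) (hφ : φ.rOut = 2 * φ.rIn) (x : Rd d) {r s : ℝ}
    (hs : 0 < s) (hsr : s ≤ r) (hφr : φ.rOut ≤ r) :
    ∫⁻ z in Metric.closedBall x s, ∫⁻ y, ENNReal.ofReal (φ.normed volume (z - y)) * u y ≤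
      4 ^ d * maximalRestricted (2 * r) (volume.withDensity u) x *
        volume (Metric.closedBall x s) := by
  set ε := φ.rOut with hε
  have hε0 : 0 < ε := φ.rOut_pos
  set ν := volume.withDensity u with hν
  set M := maximalRestricted (2 * r) ν x with hM
  have hball : ∀ σ, 0 < σ → σ ≤ 2 * r →
      ν (Metric.closedBall x σ) ≤ M * volume (Metric.closedBall x σ) := by
    intro σ hσ hσr
    rw [← ENNReal.div_le_iff (volume_closedBall_ne_zero x hσ) (volume_closedBall_ne_top x σ)]
    exact le_iSup₂ (f := fun (s : ℝ) (_ : 0 < s ∧ s ≤ 2 * r) =>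
      ν (Metric.closedBall x s) / volume (Metric.closedBall x s)) σ ⟨hσ, hσr⟩
  have hdouble : ∀ σ : ℝ, volume (Metric.closedBall x (2 * σ)) =
      2 ^ d * volume (Metric.closedBall x σ) := by
    intro σ
    simpa using volume_closedBall_mul x x (c := 2) two_pos σ
  have hsupp : ∀ w : Rd d, ε < ‖w‖ → φ.normed volume w = 0 := by
    intro w hw
    have : w ∉ Function.support (φ.normed volume) := by
      rw [φ.support_normed_eq, mem_ball_zero_iff, not_lt]
      exact hw.le
    simpa using this
  have hνB : ∀ (z : Rd d) (σ : ℝ), ν (Metric.closedBall z σ) =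
      ∫⁻ y, (Metric.closedBall z σ).indicator u y := by
    intro z σ
    rw [hν, withDensity_apply _ Metric.isClosed_closedBall.measurableSet,
      lintegral_indicator Metric.isClosed_closedBall.measurableSet]
  rcases le_or_gt ε s with hεs | hsε
  · calc ∫⁻ z in Metric.closedBall x s, ∫⁻ y, ENNReal.ofReal (φ.normed volume (z - y)) * u y
        = ∫⁻ y, ∫⁻ z in Metric.closedBall x s, ENNReal.ofReal (φ.normed volume (z - y)) * u y := by
          refine lintegral_lintegral_swap ?_
          refine AEMeasurable.mul ?_ hu.comp_snd
          exact (ENNReal.continuous_ofReal.comp (φ.continuous_normed.comp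
            (continuous_fst.sub continuous_snd))).measurable.aemeasurable
      _ ≤ ∫⁻ y, (Metric.closedBall x (2 * s)).indicator u y := by
          refine lintegral_mono fun y => ?_
          by_cases hy : y ∈ Metric.closedBall x (2 * s)
          · rw [indicator_of_mem hy, lintegral_mul_const _ (by
              exact (ENNReal.continuous_ofReal.comp (φ.continuous_normed.comp
                (continuous_id.sub continuous_const))).measurable)]
            refine mul_le_of_le_one_left' ?_
            calc ∫⁻ z in Metric.closedBall x s, ENNReal.ofReal (φ.normed volume (z - y))
                ≤ ∫⁻ z, ENNReal.ofReal (φ.normed volume (z - y)) := setLIntegral_le_lintegral _ _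
              _ = ∫⁻ z, ENNReal.ofReal (φ.normed volume z) :=
                  lintegral_sub_right_eq_self (fun z => ENNReal.ofReal (φ.normed volume z)) y
              _ = ENNReal.ofReal (∫ z, φ.normed volume z) :=
                  (ofReal_integral_eq_lintegral_ofReal φ.integrable_normed
                    (.of_forall φ.nonneg_normed)).symm
              _ = 1 := by rw [φ.integral_normed, ENNReal.ofReal_one]
              _ ≤ 1 := le_rfl
          · rw [indicator_of_notMem hy]
            refine le_of_eq (setLIntegral_eq_zero Metric.isClosed_closedBall.measurableSet ?_)
            intro z hz
            have hzy : ε < ‖z - y‖ := by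
              rw [Metric.mem_closedBall, not_le] at hy
              rw [Metric.mem_closedBall] at hz
              rw [← dist_eq_norm]
              have := dist_triangle_left y x z
              rw [dist_comm] at hz
              rw [dist_comm z x] at this
              linarith
            simp [hsupp _ hzy]
      _ = ν (Metric.closedBall x (2 * s)) := (hνB _ _).symm
      _ ≤ M * (2 ^ d * volume (Metric.closedBall x s)) := by
          rw [← hdouble]
          exact hball _ (by positivity) (by linarith)
      _ ≤ 4 ^ d * M * volume (Metric.closedBall x s) := by
          calc _ = 2 ^ d * M * volume (Metric.closedBall x s) := by ring
            _ ≤ _ := by gcongr; norm_num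
  · have hnormed : ∀ w : Rd d, ENNReal.ofReal (φ.normed volume w) ≤
        2 ^ d / volume (Metric.closedBall x ε) := by
      intro w
      have hIn : volume (Metric.closedBall x ε) =
          2 ^ d * volume (Metric.closedBall (0 : Rd d) φ.rIn) := by
        rw [hφ, hdouble, Measure.addHaar_closedBall_center]
      have h0 := volume_closedBall_ne_zero (0 : Rd d) φ.rIn_pos
      have ht := volume_closedBall_ne_top (0 : Rd d) φ.rIn
      calc ENNReal.ofReal (φ.normed volume w)
          ≤ ENNReal.ofReal (1 / volume.real (Metric.closedBall (0 : Rd d) φ.rIn)) :=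
            ENNReal.ofReal_le_ofReal (φ.normed_le_div_measure_closedBall_rIn volume w)
        _ = 1 / volume (Metric.closedBall (0 : Rd d) φ.rIn) := by
            rw [measureReal_def, ENNReal.ofReal_div_of_pos (ENNReal.toReal_pos h0 ht),
              ENNReal.ofReal_one, ENNReal.ofReal_toReal ht]
        _ = 2 ^ d / volume (Metric.closedBall x ε) := by
            rw [hIn, ← ENNReal.mul_div_mul_left 1 _ (c := 2 ^ d) (by positivity) (by finiteness),
              mul_one]
    have hε' := volume_closedBall_ne_zero x hε0
    have hpt : ∀ z ∈ Metric.closedBall x s,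
        ∫⁻ y, ENNReal.ofReal (φ.normed volume (z - y)) * u y ≤ 4 ^ d * M := by
      intro z hz
      calc ∫⁻ y, ENNReal.ofReal (φ.normed volume (z - y)) * u y
          ≤ ∫⁻ y, 2 ^ d / volume (Metric.closedBall x ε) *
              (Metric.closedBall x (2 * ε)).indicator u y := by
            refine lintegral_mono fun y => ?_
            by_cases hy : y ∈ Metric.closedBall x (2 * ε)
            · rw [indicator_of_mem hy]
              gcongr
              exact hnormed _
            · have hzy : ε < ‖z - y‖ := by
                rw [Metric.mem_closedBall, not_le] at hy
                rw [Metric.mem_closedBall] at hz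
                rw [← dist_eq_norm]
                have := dist_triangle_left y x z
                linarith
              simp [hsupp _ hzy]
        _ = 2 ^ d / volume (Metric.closedBall x ε) * ν (Metric.closedBall x (2 * ε)) := by
            rw [lintegral_const_mul' _ _ (ENNReal.div_ne_top (by finiteness) hε'), hνB]
        _ ≤ 2 ^ d / volume (Metric.closedBall x ε) *
              (M * (2 ^ d * volume (Metric.closedBall x ε))) := by
            gcongr
            rw [← hdouble]
            exact hball _ (by positivity) (by linarith)
        _ = 2 ^ d / volume (Metric.closedBall x ε) * volume (Metric.closedBall x ε) *
              (2 ^ d * M) := by ring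
        _ = 4 ^ d * M := by
            rw [ENNReal.div_mul_cancel hε' (volume_closedBall_ne_top x ε), ← mul_assoc, ← mul_pow]
            norm_num
    calc _ ≤ ∫⁻ z in Metric.closedBall x s, 4 ^ d * M :=
          setLIntegral_mono' Metric.isClosed_closedBall.measurableSet hpt
      _ = _ := setLIntegral_const _ _

/-- The pointwise estimate holds with a constant that depends on the dimension only. -/
theorem HasWeakGradient.isPointwiseConst {f : Rd d → ℝ} {G : Rd d → Rd d}
    (h : HasWeakGradient f G) : IsPointwiseConst f G (8 ^ d) := by
  set φ : ℕ → ContDiffBump (0 : Rd d) := fun n =>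
    { rIn := 1 / ((n : ℝ) + 1)
      rOut := 2 * (1 / ((n : ℝ) + 1))
      rIn_pos := Nat.one_div_pos_of_nat
      rIn_lt_rOut := by
        have : 0 < 1 / ((n : ℝ) + 1) := Nat.one_div_pos_of_nat
        linarith } with hφ
  have hlim : Tendsto (fun n => (φ n).rOut) atTop (𝓝 0) := by
    simpa [hφ] using (tendsto_one_div_add_atTop_nhds_zero_nat (𝕜 := ℝ)).const_mul 2
  have hae := ContDiffBump.ae_convolution_tendsto_right_of_locallyIntegrable (μ := volume)
    hlim (K := 2) (.of_forall fun n => le_rfl) h.locallyIntegrable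
  -- The exceptional set is where the mollifications fail to converge to `f`.
  refine ⟨by positivity, _, ae_iff.1 hae, fun x hx y hy => ?_⟩
  simp only [mem_ofPred_eq, not_not] at hx hy
  rcases eq_or_ne x y with rfl | hxy
  · simp
  have hr0 : 0 < ‖x - y‖ := norm_pos_iff.2 (sub_ne_zero.2 hxy)
  have htend := (hx.sub hy).enorm
  refine le_of_tendsto htend ?_
  -- Once the mollification scale is below `‖x - y‖`, the averages are bounded independently of `n`.
  filter_upwards [hlim.eventually_lt_const hr0] with n hn
  set F := f ⋆[(ContinuousLinearMap.lsmul ℝ ℝ).flip, volume] ((φ n).normed volume) with hF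
  have hconv : (φ n).normed volume ⋆[ContinuousLinearMap.lsmul ℝ ℝ, volume] f = F := by
    rw [hF, convolution_flip]
  rw [hconv]
  have hFc : ContDiff ℝ 1 F :=
    (φ n).hasCompactSupport_normed.contDiff_convolution_right (n := 1) _ h.locallyIntegrable
      (φ n).contDiff_normed
  have hbound : ∀ (z : Rd d) (s : ℝ), 0 < s → s ≤ ‖x - y‖ →
      ∫⁻ w in Metric.closedBall z s, ‖fderiv ℝ F w‖ₑ ≤
        4 ^ d * maximalRestricted (2 * ‖x - y‖) (absMeasure G) z *
          volume (Metric.closedBall z s) := by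
    intro z s hs hsr
    refine le_trans (lintegral_mono fun w => h.enorm_fderiv_convolution_le (φ n).contDiff_normed
      (φ n).hasCompactSupport_normed (φ n).nonneg_normed w) ?_
    exact setLIntegral_mollified_le h.locallyIntegrable_grad.aestronglyMeasurable.enorm (φ n) rfl
      z hs hsr hn.le
  refine (enorm_sub_le_of_fderiv_average_le hFc hxy (hbound x) (hbound y)).trans_eq ?_
  have h8 : ((8 ^ d : ℝ≥0) : ℝ≥0∞) = 2 ^ d * 4 ^ d := by
    rw [← mul_pow]; push_cast; norm_num
  rw [h8]; ring

end OrliczAvikainen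

namespace OrliczAvikainen

/-! ### Moments of `f(X) - f(X')` -/

variable {d : ℕ}

theorem gap_pos {q : ℝ} {r : ℝ≥0∞} (hr : 1 < r) (hqr : ENNReal.ofReal q < r) : 0 < gap q r := by
  induction r with
  | top => simp [gap]
  | coe r =>
    have hr0 : (0 : ℝ) < r := zero_lt_one.trans (by exact_mod_cast hr)
    have hqr' : q < r := by
      rw [← ENNReal.ofReal_coe_nnreal] at hqr
      exact (ENNReal.ofReal_lt_ofReal_iff hr0).1 hqr
    rw [gap, ENNReal.toReal_inv, ENNReal.coe_toReal, sub_pos, ← div_eq_mul_inv, div_lt_one hr0]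
    exact hqr'

section Density

variable {Ω : Type*} [MeasurableSpace Ω] {P : Measure Ω} {X X' : Ω → Rd d} {p p' : Rd d → ℝ≥0}

theorem IsDensity.quasiMeasurePreserving (hp : IsDensity P X p) (hX : Measurable X) :
    Measure.QuasiMeasurePreserving X P volume :=
  ⟨hX, by rw [hp.map_eq]; exact withDensity_absolutelyContinuous _ _⟩

theorem IsDensity.lintegral_comp (hp : IsDensity P X p) (hX : Measurable X) {u : Rd d → ℝ≥0∞}
    (hu : AEMeasurable u) : ∫⁻ ω, u (X ω) ∂P = ∫⁻ x, u x * p x := by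
  have hpm : Measurable fun x => (p x : ℝ≥0∞) := hp.measurable.coe_nnreal_ennreal
  have hu' : AEMeasurable u (P.map X) := hu.mono_ac (hp.quasiMeasurePreserving hX).2
  rw [← lintegral_map' hu' hX.aemeasurable, hp.map_eq,
    lintegral_withDensity_eq_lintegral_mul₀ hpm.aemeasurable hu]
  exact lintegral_congr fun x => mul_comm _ _

/-- For `r = ∞` equality may fail: the right side is an essential supremum for Lebesgue measure,
which has fewer null sets than the law of `X` may have. -/
theorem IsDensity.eLpNorm_comp_le (hp : IsDensity P X p) (hX : Measurable X) {f : Rd d → ℝ}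
    (hf : AEStronglyMeasurable f) {r : ℝ≥0∞} (hr : 1 < r) :
    eLpNorm (fun ω => f (X ω)) r P ≤ weightedNorm r p f := by
  rw [weightedNorm]
  split_ifs with h
  · rw [h, eLpNorm_exponent_top]
    refine essSup_le_of_ae_le _ ?_
    exact (hp.quasiMeasurePreserving hX).ae (ENNReal.ae_le_essSup fun x => ‖f x‖ₑ)
  · rw [eLpNorm_eq_lintegral_rpow_enorm_toReal (zero_lt_one.trans hr).ne' h,
      ← hp.lintegral_comp hX (hf.enorm.pow_const _)]

/-- Hölder's inequality for the moment of order `q` on an event. -/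
theorem setLIntegral_enorm_sub_rpow_le (hX : Measurable X) (hX' : Measurable X')
    (hp : IsDensity P X p) (hp' : IsDensity P X' p') {r : ℝ≥0∞} {q : ℝ} (hr : 1 < r) (hq : 0 < q)
    (hqr : ENNReal.ofReal q < r) {f : Rd d → ℝ} (hf : AEStronglyMeasurable f) (S : Set Ω) :
    ∫⁻ ω in S, ‖f (X ω) - f (X' ω)‖ₑ ^ q ∂P ≤
      (weightedNorm r p f + weightedNorm r p' f) ^ q * P S ^ gap q r := by
  have hfX : AEStronglyMeasurable (fun ω => f (X ω)) P :=
    hf.comp_quasiMeasurePreserving (hp.quasiMeasurePreserving hX)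
  have hfX' : AEStronglyMeasurable (fun ω => f (X' ω)) P :=
    hf.comp_quasiMeasurePreserving (hp'.quasiMeasurePreserving hX')
  set g : Ω → ℝ := fun ω => f (X ω) - f (X' ω) with hg
  have hgm : AEStronglyMeasurable g P := hfX.sub hfX'
  have hnorm : eLpNorm g r P ≤ weightedNorm r p f + weightedNorm r p' f :=
    (eLpNorm_sub_le hfX hfX' hr.le).trans
      (add_le_add (hp.eLpNorm_comp_le hX hf hr) (hp'.eLpNorm_comp_le hX' hf hr))
  have h1 := eLpNorm_le_eLpNorm_mul_rpow_measure_univ hqr.le (hgm.restrict (s := S))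
  rw [eLpNorm_eq_lintegral_rpow_enorm_toReal (by simpa using hq) ENNReal.ofReal_ne_top,
    Measure.restrict_apply_univ, ENNReal.toReal_ofReal hq.le] at h1
  calc ∫⁻ ω in S, ‖g ω‖ₑ ^ q ∂P = ((∫⁻ ω in S, ‖g ω‖ₑ ^ q ∂P) ^ (1 / q)) ^ q := by
        rw [← ENNReal.rpow_mul, one_div_mul_cancel hq.ne', ENNReal.rpow_one]
    _ ≤ (eLpNorm g r (P.restrict S) * P S ^ (1 / q - 1 / r.toReal)) ^ q := by gcongr
    _ = eLpNorm g r (P.restrict S) ^ q * P S ^ gap q r := by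
        rw [ENNReal.mul_rpow_of_nonneg _ _ hq.le, ← ENNReal.rpow_mul, gap, ENNReal.toReal_inv]
        congr 2
        field_simp
    _ ≤ _ := by
        gcongr
        exact (eLpNorm_restrict_le _ _ _ _).trans hnorm

/-- The common core of both estimates: the Lipschitz bound when both variables avoid `W`, Hölder on
the event that one of them hits it. -/
theorem lintegral_enorm_sub_rpow_le_of_good_set (hX : Measurable X) (hX' : Measurable X')
    (hp : IsDensity P X p) (hp' : IsDensity P X' p') {r : ℝ≥0∞} {q : ℝ} (hr : 1 < r) (hq : 0 < q)
    (hqr : ENNReal.ofReal q < r) {f : Rd d → ℝ} (hf : AEStronglyMeasurable f)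
    {W : Set (Rd d)} (hW : MeasurableSet W) {c : ℝ≥0∞}
    (hgood : ∀ x ∉ W, ∀ y ∉ W, ‖f x - f y‖ₑ ≤ c * ‖x - y‖ₑ) :
    ∫⁻ ω, ‖f (X ω) - f (X' ω)‖ₑ ^ q ∂P ≤
      c ^ q * ∫⁻ ω, ‖X ω - X' ω‖ₑ ^ q ∂P +
        (weightedNorm r p f + weightedNorm r p' f) ^ q *
          (P (X ⁻¹' W) + P (X' ⁻¹' W)) ^ gap q r := by
  set S := X ⁻¹' W ∪ X' ⁻¹' W with hS
  have hSm : MeasurableSet S := (hX hW).union (hX' hW)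
  rw [← lintegral_add_compl _ hSm, add_comm]
  gcongr
  · have hm : Measurable fun ω => ‖X ω - X' ω‖ₑ ^ q := (hX.sub hX').enorm.pow_const q
    rw [← lintegral_const_mul _ hm]
    refine (setLIntegral_mono' hSm.compl fun ω hω => ?_).trans (setLIntegral_le_lintegral _ _)
    simp only [hS, mem_compl_iff, mem_union, mem_preimage, not_or] at hω
    rw [← ENNReal.mul_rpow_of_nonneg _ _ hq.le]
    gcongr
    exact hgood _ hω.1 _ hω.2
  · refine (setLIntegral_enorm_sub_rpow_le hX hX' hp hp' hr hq hqr hf S).trans ?_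
    have := (gap_pos hr hqr).le
    gcongr
    exact measure_union_le _ _

theorem IsDensity.measure_preimage_le (hp : IsDensity P X p) (hX : Measurable X)
    {W : Set (Rd d)} (hW : MeasurableSet W) : P (X ⁻¹' W) ≤ supNorm p * volume W := by
  rw [← Measure.map_apply hX hW, hp.map_eq, withDensity_apply _ hW, ← setLIntegral_const]
  exact lintegral_mono_ae (ae_restrict_of_ae (ENNReal.ae_le_essSup _))

theorem IsDensity.measure_preimage_lt_le (hp : IsDensity P X p) (hX : Measurable X)
    {u : Rd d → ℝ≥0∞} (hu : Measurable u) {t : ℝ≥0} (ht : 0 < t) :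
    P (X ⁻¹' {x | (t : ℝ≥0∞) < u x}) ≤ (∫⁻ x, u x * p x) / t := by
  rw [ENNReal.le_div_iff_mul_le (.inl (by simpa using ht.ne')) (.inl ENNReal.coe_ne_top), mul_comm,
    ← hp.lintegral_comp hX hu.aemeasurable]
  refine le_trans ?_ (mul_meas_ge_le_lintegral (hu.comp hX) t)
  gcongr
  intro ω hω
  exact le_of_lt (show (t : ℝ≥0∞) < u (X ω) from hω)

end Density

/-! ### Jensen's inequality for the maximal function -/

/-- Integrate over a ball a supporting line lying strictly above `t` at `y`, then cancel. No
integrability of `u` is needed. -/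
theorem maximal_le_genInverse {Φ : ℝ≥0 → ℝ≥0∞} (hΦ : IsYoung Φ) (hc : Continuous Φ)
    {u : Rd d → ℝ≥0∞} {x : Rd d} {t : ℝ≥0∞}
    (h : maximal (volume.withDensity fun y => extend Φ (u y)) x ≤ t) :
    maximal (volume.withDensity u) x ≤ genInverse Φ t := by
  refine le_iInf₂ fun y hy => maximal_le_iff.2 fun s hs => ?_
  have hB : MeasurableSet (Metric.closedBall x s) := Metric.isClosed_closedBall.measurableSet
  have hI := maximal_le_iff.1 h s hs
  rw [withDensity_apply _ hB] at hI ⊢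
  have hV0 := volume_closedBall_ne_zero x hs
  have hVt := volume_closedBall_ne_top x s
  set V := volume (Metric.closedBall x s)
  obtain ⟨m, htm, hm⟩ := ENNReal.lt_iff_exists_nnreal_btwn.1 hy
  obtain ⟨ξ, hξ⟩ := hΦ.exists_supporting_line hc hm
  -- A zero slope would give `m ≤ Φ 0 = 0`, against `t < m`.
  have hξ0 : ξ ≠ 0 := by
    rintro rfl
    have := hξ 0
    simp only [hΦ.map_zero, ENNReal.coe_zero, zero_mul, add_zero, nonpos_iff_eq_zero] at this
    simp [this] at htm
  have hξ' : ∀ z : ℝ≥0∞, (m : ℝ≥0∞) + ξ * z ≤ extend Φ z + ξ * y := by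
    intro z
    induction z with
    | top => simp
    | coe z => simpa using hξ z
  have hint : (m : ℝ≥0∞) * V + ξ * ∫⁻ z in Metric.closedBall x s, u z ≤
      m * V + ξ * (y * V) := by
    calc (m : ℝ≥0∞) * V + ξ * ∫⁻ z in Metric.closedBall x s, u z
        = ∫⁻ z in Metric.closedBall x s, ((m : ℝ≥0∞) + ξ * u z) := by
          rw [lintegral_add_left measurable_const, setLIntegral_const,
            lintegral_const_mul' _ _ ENNReal.coe_ne_top]
      _ ≤ ∫⁻ z in Metric.closedBall x s, (extend Φ (u z) + ξ * y) :=
          lintegral_mono fun z => hξ' _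
      _ = (∫⁻ z in Metric.closedBall x s, extend Φ (u z)) + ξ * y * V := by
          rw [lintegral_add_right _ measurable_const, setLIntegral_const]
      _ ≤ t * V + ξ * y * V := by gcongr
      _ ≤ m * V + ξ * (y * V) := by rw [mul_assoc]; gcongr
  have h2 := (ENNReal.add_le_add_iff_left (ENNReal.mul_ne_top ENNReal.coe_ne_top hVt)).1 hint
  exact (ENNReal.mul_le_mul_iff_right (by simpa using hξ0) ENNReal.coe_ne_top).1 h2

/-! ### The two estimates -/

/-- The null set is enlarged to a measurable one, chosen before the level `c` so that it serves all
levels. -/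
theorem IsPointwiseConst.enorm_sub_le {f : Rd d → ℝ} {Df : Rd d → Rd d} {K : ℝ≥0}
    (hK : IsPointwiseConst f Df K) : ∃ N : Set (Rd d), MeasurableSet N ∧ volume N = 0 ∧
      ∀ c : ℝ≥0∞, ∀ x ∉ N ∪ {x | c < maximal (absMeasure Df) x},
        ∀ y ∉ N ∪ {x | c < maximal (absMeasure Df) x}, ‖f x - f y‖ₑ ≤ 2 * K * c * ‖x - y‖ₑ := by
  obtain ⟨-, N, hN, h⟩ := hK
  refine ⟨toMeasurable volume N, measurableSet_toMeasurable _ _, by rwa [measure_toMeasurable],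
    fun c x hx y hy => ?_⟩
  simp only [mem_union, mem_ofPred_eq, not_or, not_lt] at hx hy
  refine (h x (fun hxN => hx.1 (subset_toMeasurable _ _ hxN)) y
    (fun hyN => hy.1 (subset_toMeasurable _ _ hyN))).trans ?_
  calc _ ≤ (K : ℝ≥0∞) * ‖x - y‖ₑ * (c + c) := by
        gcongr
        · exact (maximalRestricted_le_maximal _ _ _).trans hx.2
        · exact (maximalRestricted_le_maximal _ _ _).trans hy.2
    _ = _ := by ring

section Estimates

variable {Ω : Type*} [MeasurableSpace Ω] {P : Measure Ω} {X X' : Ω → Rd d} {p p' : Rd d → ℝ≥0}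
  {Φ : ℝ≥0 → ℝ≥0∞} {r : ℝ≥0∞} {f : Rd d → ℝ} {Df : Rd d → Rd d} {q : ℝ}

theorem IsDensity.measure_preimage_union (hp : IsDensity P X p) (hX : Measurable X)
    {N : Set (Rd d)} (hN : volume N = 0) (W : Set (Rd d)) :
    P (X ⁻¹' (N ∪ W)) ≤ P (X ⁻¹' W) := by
  rw [preimage_union]
  refine (measure_union_le _ _).trans ?_
  rw [(hp.quasiMeasurePreserving hX).preimage_null hN, zero_add]

theorem constBounded_lt_top (hr : 1 < r) (hq : 0 < q) (hqr : ENNReal.ofReal q < r)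
    (hpf : weightedNorm r p f < ∞) (hpf' : weightedNorm r p' f < ∞) (hsp : supNorm p < ∞)
    (hsp' : supNorm p' < ∞) {α : ℝ≥0} (K A : ℝ≥0) (hα : 0 < α)
    (hmod : modular Φ (fun x => α * ‖Df x‖ₑ) < ∞) :
    constBounded Φ f Df p p' q r α K A < ∞ := by
  have hgap := (gap_pos hr hqr).le
  refine max_lt (ENNReal.rpow_lt_top_of_nonneg hq.le ?_) ?_
  · exact ENNReal.div_ne_top (by finiteness) (by simpa using hα.ne')
  · refine ENNReal.mul_lt_top (ENNReal.rpow_lt_top_of_nonneg hq.le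
      (ENNReal.add_lt_top.2 ⟨hpf, hpf'⟩).ne) (ENNReal.rpow_lt_top_of_nonneg hgap ?_)
    exact ENNReal.mul_ne_top (ENNReal.mul_ne_top ENNReal.coe_ne_top
      (ENNReal.add_lt_top.2 ⟨hsp, hsp'⟩).ne) hmod.ne

theorem lintegral_enorm_sub_rpow_le_constBounded (hΦ : IsYoung Φ) (hc : Continuous Φ)
    (hX : Measurable X) (hX' : Measurable X') (hp : IsDensity P X p) (hp' : IsDensity P X' p')
    (hr : 1 < r) (hq : 0 < q) (hqr : ENNReal.ofReal q < r) (hf : AEStronglyMeasurable f)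
    {K A α t : ℝ≥0} (hK : IsPointwiseConst f Df K) (hA : IsWeakTypeConst d A) (hα : 0 < α)
    (hmod : modular Φ (fun x => α * ‖Df x‖ₑ) < ∞) (ht : 0 < t) :
    ∫⁻ ω, ‖f (X ω) - f (X' ω)‖ₑ ^ q ∂P ≤ constBounded Φ f Df p p' q r α K A *
      ((t : ℝ≥0∞) ^ (-gap q r) + genInverse Φ t ^ q * ∫⁻ ω, ‖X ω - X' ω‖ₑ ^ q ∂P) := by
  obtain ⟨N, hNm, hN0, hN⟩ := hK.enorm_sub_le
  have hgap := gap_pos hr hqr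
  have hα0 : (α : ℝ≥0∞) ≠ 0 := by simpa using hα.ne'
  -- The bad set is defined through this finite measure rather than through `Df`: the weak type
  -- bound applies to it directly, and Jensen transfers the bound to `Df` off the bad set.
  set ν : Measure (Rd d) := volume.withDensity fun x => extend Φ (α * ‖Df x‖ₑ) with hν
  have hνfin : IsFiniteMeasure ν := isFiniteMeasure_withDensity hmod.ne
  have hνuniv : ν univ = modular Φ (fun x => α * ‖Df x‖ₑ) := by
    rw [hν, withDensity_apply _ MeasurableSet.univ, setLIntegral_univ]; rfl
  set W : Set (Rd d) := {x | (t : ℝ≥0∞) < maximal ν x} with hW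
  have hWm : MeasurableSet W := (isOpen_lt_maximal ν t).measurableSet
  have hWvol : volume W ≤ A * modular Φ (fun x => α * ‖Df x‖ₑ) / t := by
    rw [← hνuniv]; exact hA.2 ν hνfin t ht
  have hsub : ∀ x ∉ N ∪ W, x ∉ N ∪ {x | genInverse Φ t / α < maximal (absMeasure Df) x} := by
    intro x hx
    simp only [hW, mem_union, mem_ofPred_eq, not_or, not_lt] at hx ⊢
    refine ⟨hx.1, ?_⟩
    rw [ENNReal.le_div_iff_mul_le (.inl hα0) (.inl ENNReal.coe_ne_top), mul_comm, ← maximal_smul]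
    have h1 : (α : ℝ≥0∞) • absMeasure Df = volume.withDensity fun x => α * ‖Df x‖ₑ :=
      (withDensity_smul' _ _ ENNReal.coe_ne_top).symm
    rw [h1]
    exact maximal_le_genInverse hΦ hc hx.2
  have hmain := lintegral_enorm_sub_rpow_le_of_good_set hX hX' hp hp' hr hq hqr hf
    (hNm.union hWm) (c := 2 * K * (genInverse Φ t / α))
    fun x hx y hy => hN _ x (hsub x hx) y (hsub y hy)
  refine hmain.trans ?_
  have hprob : P (X ⁻¹' (N ∪ W)) + P (X' ⁻¹' (N ∪ W)) ≤
      A * (supNorm p + supNorm p') * modular Φ (fun x => α * ‖Df x‖ₑ) * (t : ℝ≥0∞)⁻¹ := by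
    calc _ ≤ supNorm p * volume W + supNorm p' * volume W :=
          add_le_add ((hp.measure_preimage_union hX hN0 W).trans (hp.measure_preimage_le hX hWm))
            ((hp'.measure_preimage_union hX' hN0 W).trans (hp'.measure_preimage_le hX' hWm))
      _ = (supNorm p + supNorm p') * volume W := (add_mul _ _ _).symm
      _ ≤ (supNorm p + supNorm p') * (A * modular Φ (fun x => α * ‖Df x‖ₑ) / t) := by gcongr
      _ = _ := by rw [div_eq_mul_inv]; ring
  rw [mul_add, add_comm]
  gcongr ?_ + ?_
  · calc _ ≤ (weightedNorm r p f + weightedNorm r p' f) ^ q *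
          (A * (supNorm p + supNorm p') * modular Φ (fun x => α * ‖Df x‖ₑ) *
            (t : ℝ≥0∞)⁻¹) ^ gap q r := by gcongr
      _ = (weightedNorm r p f + weightedNorm r p' f) ^ q *
          (A * (supNorm p + supNorm p') * modular Φ (fun x => α * ‖Df x‖ₑ)) ^ gap q r *
            (t : ℝ≥0∞) ^ (-gap q r) := by
          rw [ENNReal.mul_rpow_of_nonneg _ _ hgap.le, ENNReal.inv_rpow, ENNReal.rpow_neg]
          ring
      _ ≤ _ := by gcongr; exact le_max_right _ _
  · rw [show 2 * (K : ℝ≥0∞) * (genInverse Φ t / α) = 2 * K / α * genInverse Φ t by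
      simp only [div_eq_mul_inv]; ring, ENNReal.mul_rpow_of_nonneg _ _ hq.le, mul_assoc]
    gcongr
    exact le_max_left _ _

theorem constOrlicz_lt_top (hr : 1 < r) (hq : 0 < q) (hqr : ENNReal.ofReal q < r)
    (hpf : weightedNorm r p f < ∞) (hpf' : weightedNorm r p' f < ∞)
    (hlp : luxNorm (complementary Φ) (fun x => (p x : ℝ≥0∞)) < ∞)
    (hlp' : luxNorm (complementary Φ) (fun x => (p' x : ℝ≥0∞)) < ∞)
    (hlD : luxNorm Φ (fun x => ‖Df x‖ₑ) < ∞) (K A : ℝ≥0) :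
    constOrlicz Φ f Df p p' q r K A < ∞ := by
  have hgap := (gap_pos hr hqr).le
  refine ENNReal.add_lt_top.2 ⟨ENNReal.rpow_lt_top_of_nonneg hq.le (by finiteness), ?_⟩
  refine ENNReal.mul_lt_top (ENNReal.rpow_lt_top_of_nonneg hq.le
    (ENNReal.add_lt_top.2 ⟨hpf, hpf'⟩).ne) (ENNReal.rpow_lt_top_of_nonneg hgap ?_)
  exact ENNReal.mul_ne_top (ENNReal.mul_ne_top (by finiteness)
    (ENNReal.add_lt_top.2 ⟨hlp, hlp'⟩).ne) hlD.ne

theorem lintegral_enorm_sub_rpow_le_add (hX : Measurable X) (hX' : Measurable X')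
    (hp : IsDensity P X p) (hp' : IsDensity P X' p') (hr : 1 < r) (hq : 0 < q)
    (hqr : ENNReal.ofReal q < r) (hf : AEStronglyMeasurable f)
    (hlp : luxNorm (complementary Φ) (fun x => (p x : ℝ≥0∞)) < ∞)
    (hlp' : luxNorm (complementary Φ) (fun x => (p' x : ℝ≥0∞)) < ∞)
    (hlD : luxNorm Φ (fun x => ‖Df x‖ₑ) < ∞) (hDf : AEStronglyMeasurable Df)
    (hmem : MemOrlicz Φ fun x => ‖Df x‖ₑ)
    {K A t : ℝ≥0} (hK : IsPointwiseConst f Df K) (hA : IsStrongTypeConst d Φ A) (ht : 0 < t) :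
    ∫⁻ ω, ‖f (X ω) - f (X' ω)‖ₑ ^ q ∂P ≤
      (2 * (K : ℝ≥0∞)) ^ q * ((t : ℝ≥0∞) ^ q * ∫⁻ ω, ‖X ω - X' ω‖ₑ ^ q ∂P) +
      (weightedNorm r p f + weightedNorm r p' f) ^ q *
      (2 * A * (luxNorm (complementary Φ) (fun x => (p x : ℝ≥0∞)) +
          luxNorm (complementary Φ) (fun x => (p' x : ℝ≥0∞))) *
        luxNorm Φ (fun x => ‖Df x‖ₑ)) ^ gap q r * (t : ℝ≥0∞) ^ (-gap q r) := by
  obtain ⟨N, hNm, hN0, hN⟩ := hK.enorm_sub_le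
  have hgap := gap_pos hr hqr
  set W : Set (Rd d) := {x | (t : ℝ≥0∞) < maximal (absMeasure Df) x} with hW
  have hMm : Measurable (maximal (absMeasure Df)) := measurable_maximal _
  have hWm : MeasurableSet W := (isOpen_lt_maximal _ t).measurableSet
  have hM : luxNorm Φ (maximal (absMeasure Df)) ≤ A * luxNorm Φ (fun x => ‖Df x‖ₑ) := by
    -- The strong type bound concerns scalar functions, so it is applied to `|Df|`, which has the
    -- same maximal function.
    have h1 := hA.2 (fun x => ‖Df x‖) hDf.norm.aemeasurable (by simpa only [enorm_norm] using hmem)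
    have h2 : absMeasure (fun x => ‖Df x‖) = absMeasure Df := by simp only [absMeasure, enorm_norm]
    simpa only [h2, enorm_norm] using h1
  have hMfin : luxNorm Φ (maximal (absMeasure Df)) ≠ ∞ :=
    ne_top_of_le_ne_top (ENNReal.mul_ne_top ENNReal.coe_ne_top hlD.ne) hM
  have hprob : ∀ (Y : Ω → Rd d) (ρ : Rd d → ℝ≥0), Measurable Y → IsDensity P Y ρ →
      luxNorm (complementary Φ) (fun x => (ρ x : ℝ≥0∞)) < ∞ →
      P (Y ⁻¹' (N ∪ W)) ≤ 2 * A * luxNorm (complementary Φ) (fun x => (ρ x : ℝ≥0∞)) *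
        luxNorm Φ (fun x => ‖Df x‖ₑ) * (t : ℝ≥0∞)⁻¹ := by
    intro Y ρ hY hρ hfin
    refine (hρ.measure_preimage_union hY hN0 W).trans
      ((hρ.measure_preimage_lt_le hY hMm ht).trans ?_)
    rw [div_eq_mul_inv]
    gcongr
    calc _ ≤ 2 * luxNorm Φ (maximal (absMeasure Df)) *
            luxNorm (complementary Φ) (fun x => (ρ x : ℝ≥0∞)) :=
          lintegral_mul_le_luxNorm hρ.measurable.coe_nnreal_ennreal.aemeasurable hMfin hfin.ne
      _ ≤ 2 * (A * luxNorm Φ (fun x => ‖Df x‖ₑ)) *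
            luxNorm (complementary Φ) (fun x => (ρ x : ℝ≥0∞)) := by gcongr
      _ = _ := by ring
  refine (lintegral_enorm_sub_rpow_le_of_good_set hX hX' hp hp' hr hq hqr hf
    (hNm.union hWm) (hN t)).trans ?_
  rw [ENNReal.mul_rpow_of_nonneg _ _ hq.le, mul_assoc, mul_assoc (_ ^ q)]
  gcongr _ + _ * ?_
  rw [ENNReal.rpow_neg, ← ENNReal.inv_rpow, ← ENNReal.mul_rpow_of_nonneg _ _ hgap.le]
  gcongr
  exact (add_le_add (hprob X p hX hp hlp) (hprob X' p' hX' hp' hlp')).trans_eq (by ring)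

theorem lintegral_enorm_sub_rpow_le_constOrlicz (hX : Measurable X) (hX' : Measurable X')
    (hp : IsDensity P X p) (hp' : IsDensity P X' p') (hr : 1 < r) (hq : 0 < q)
    (hqr : ENNReal.ofReal q < r) (hf : AEStronglyMeasurable f)
    (hlp : luxNorm (complementary Φ) (fun x => (p x : ℝ≥0∞)) < ∞)
    (hlp' : luxNorm (complementary Φ) (fun x => (p' x : ℝ≥0∞)) < ∞)
    (hlD : luxNorm Φ (fun x => ‖Df x‖ₑ) < ∞) (hDf : AEStronglyMeasurable Df)
    (hmem : MemOrlicz Φ fun x => ‖Df x‖ₑ)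
    {K A : ℝ≥0} (hK : IsPointwiseConst f Df K) (hA : IsStrongTypeConst d Φ A) :
    ∫⁻ ω, ‖f (X ω) - f (X' ω)‖ₑ ^ q ∂P ≤ constOrlicz Φ f Df p p' q r K A *
      (∫⁻ ω, ‖X ω - X' ω‖ₑ ^ q ∂P) ^ (gap q r / (q + gap q r)) := by
  have hgap := gap_pos hr hqr
  have hexp : 0 < gap q r / (q + gap q r) := by positivity
  set E := ∫⁻ ω, ‖X ω - X' ω‖ₑ ^ q ∂P with hE
  -- The optimal level is `∞` for `E = 0` and `0` for `E = ∞`, so these cases are separate: the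
  -- variables agree almost surely, or the right side is infinite because `K > 0`.
  rcases eq_or_ne E 0 with h0 | h0
  · have hXX : ∀ᵐ ω ∂P, ‖X ω - X' ω‖ₑ ^ q = 0 :=
      (lintegral_eq_zero_iff ((hX.sub hX').enorm.pow_const q)).1 h0
    have hzero : ∫⁻ ω, ‖f (X ω) - f (X' ω)‖ₑ ^ q ∂P = 0 := by
      rw [← lintegral_zero (μ := P)]
      refine lintegral_congr_ae ?_
      filter_upwards [hXX] with ω hω
      have : X ω = X' ω := by simpa [ENNReal.rpow_eq_zero_iff_of_pos hq, sub_eq_zero] using hω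
      simp [this, hq]
    rw [hzero]
    exact zero_le
  rcases eq_or_ne E ∞ with htop | htop
  · have hC : constOrlicz Φ f Df p p' q r K A ≠ 0 := by
      have : (2 * (K : ℝ≥0∞)) ^ q ≠ 0 := by
        simp [ENNReal.rpow_eq_zero_iff_of_pos hq, hK.1.ne']
      simp [constOrlicz, this]
    rw [htop, ENNReal.top_rpow_of_pos hexp, ENNReal.mul_top hC]
    exact le_top
  -- The level that balances `s ^ q * E` against `s ^ (-gap q r)`.
  set s : ℝ≥0∞ := E ^ (-(1 / (q + gap q r))) with hs
  have hs0 : s ≠ 0 := (ENNReal.rpow_pos (pos_iff_ne_zero.2 h0) htop).ne'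
  have hst : s ≠ ∞ := ENNReal.rpow_ne_top_of_ne_zero h0 htop
  have ht : 0 < s.toNNReal := ENNReal.toNNReal_pos hs0 hst
  refine (lintegral_enorm_sub_rpow_le_add hX hX' hp hp' hr hq hqr hf hlp hlp' hlD hDf hmem hK hA
    ht).trans_eq ?_
  rw [ENNReal.coe_toNNReal hst, constOrlicz, add_mul, ← hE]
  have hsum : q + gap q r ≠ 0 := by positivity
  have e1 : s ^ q * E = E ^ (gap q r / (q + gap q r)) := by
    rw [hs, ← ENNReal.rpow_mul]
    nth_rw 2 [← ENNReal.rpow_one E]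
    rw [← ENNReal.rpow_add _ _ h0 htop]
    congr 1
    field_simp
    ring
  have e2 : s ^ (-gap q r) = E ^ (gap q r / (q + gap q r)) := by
    rw [hs, ← ENNReal.rpow_mul]
    congr 1
    field_simp
  rw [e1, e2]

end Estimates

end OrliczAvikainen

theorem theorem2p17 (d : ℕ) (hd : 0 < d) (Φ : ℝ≥0 → ℝ≥0∞) (hΦ : IsNFunction Φ)
    (hΨ : Delta2 (complementary Φ)) :
    -- the constants `K₀`, `A₁`, `AΦ` exist; `K₀` and `A₁` can be taken to depend on `d` only
    (∃ K₀ : ℝ≥0, ∀ (f : Rd d → ℝ) (Df : Rd d → Rd d), HasWeakGradient f Df →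
      IsPointwiseConst f Df K₀) ∧
    (∃ A₁ : ℝ≥0, IsWeakTypeConst d A₁) ∧
    (∃ AΦ : ℝ≥0, IsStrongTypeConst d Φ AΦ) ∧
    ∀ (Ω : Type*) [MeasurableSpace Ω] (P : Measure Ω) [IsProbabilityMeasure P]
      (X X' : Ω → Rd d) (p p' : Rd d → ℝ≥0) (r : ℝ≥0∞) (f : Rd d → ℝ) (Df : Rd d → Rd d) (q : ℝ),
      Measurable X → Measurable X' → IsDensity P X p → IsDensity P X' p' →
      1 < r → MemOrliczSobolev Φ f Df →
      weightedNorm r p f < ∞ → weightedNorm r p' f < ∞ →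
      0 < q → ENNReal.ofReal q < r →
      -- bounded densities
      (supNorm p < ∞ → supNorm p' < ∞ →
        ∀ K₀ A₁ α : ℝ≥0, IsPointwiseConst f Df K₀ → IsWeakTypeConst d A₁ →
          0 < α → modular Φ (fun x => α * ‖Df x‖ₑ) < ∞ →
          constBounded Φ f Df p p' q r α K₀ A₁ < ∞ ∧
          ∫⁻ ω, ‖f (X ω) - f (X' ω)‖ₑ ^ q ∂P ≤
            constBounded Φ f Df p p' q r α K₀ A₁ *
              ⨅ (t : ℝ≥0) (_ : 0 < t),
                ((t : ℝ≥0∞) ^ (-gap q r) +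
                  genInverse Φ t ^ q * ∫⁻ ω, ‖X ω - X' ω‖ₑ ^ q ∂P)) ∧
      -- densities in `L^Ψ`
      (MemOrlicz (complementary Φ) (fun x => (p x : ℝ≥0∞)) →
        MemOrlicz (complementary Φ) (fun x => (p' x : ℝ≥0∞)) →
        ∀ K₀ AΦ : ℝ≥0, IsPointwiseConst f Df K₀ → IsStrongTypeConst d Φ AΦ →
          constOrlicz Φ f Df p p' q r K₀ AΦ < ∞ ∧
          ∫⁻ ω, ‖f (X ω) - f (X' ω)‖ₑ ^ q ∂P ≤
            constOrlicz Φ f Df p p' q r K₀ AΦ *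
              (∫⁻ ω, ‖X ω - X' ω‖ₑ ^ q ∂P) ^ (gap q r / (q + gap q r))) := by
  refine ⟨⟨8 ^ d, fun f Df h => h.isPointwiseConst⟩, ⟨5 ^ d, isWeakTypeConst hd⟩,
    exists_isStrongTypeConst hd hΦ.toIsYoung hΦ.continuous hΨ, ?_⟩
  intro Ω _ P _ X X' p p' r f Df q hX hX' hp hp' hr hf hpf hpf' hq hqr
  have hfm : AEStronglyMeasurable f := hf.weakGradient.locallyIntegrable.aestronglyMeasurable
  refine ⟨fun hsp hsp' K A α hK hA hα hmod => ?_, fun hmp hmp' K A hK hA => ?_⟩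
  · have hfin := constBounded_lt_top hr hq hqr hpf hpf' hsp hsp' K A hα hmod
    refine ⟨hfin, ?_⟩
    -- A nonzero finite constant can be divided out, which reduces the infimum to a bound for each
    -- `t`.
    have hne : constBounded Φ f Df p p' q r α K A ≠ 0 := by
      refine (lt_of_lt_of_le (ENNReal.rpow_pos (ENNReal.div_pos ?_ ENNReal.coe_ne_top) ?_)
        (le_max_left _ _)).ne'
      · simpa using hK.1.ne'
      · exact ENNReal.div_ne_top (by finiteness) (by simpa using hα.ne')
    rw [mul_comm, ← ENNReal.div_le_iff_le_mul (.inl hne) (.inl hfin.ne)]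
    exact le_iInf₂ fun t ht => ENNReal.div_le_of_le_mul'
      (lintegral_enorm_sub_rpow_le_constBounded hΦ.toIsYoung hΦ.continuous hX hX' hp hp' hr hq hqr
        hfm hK hA hα hmod ht)
  · have hlp := hmp.luxNorm_lt_top fun _ => complementary_mul_le
    have hlp' := hmp'.luxNorm_lt_top fun _ => complementary_mul_le
    have hlD := hf.mem_grad.luxNorm_lt_top fun _ => hΦ.toIsYoung.map_mul_le
    exact ⟨constOrlicz_lt_top hr hq hqr hpf hpf' hlp hlp' hlD K A,
      lintegral_enorm_sub_rpow_le_constOrlicz hX hX' hp hp' hr hq hqr hfm hlp hlp' hlD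
        hf.weakGradient.locallyIntegrable_grad.aestronglyMeasurable hf.mem_grad hK hA⟩
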